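/- Let $d\in\mathbb N$ and let $(M_p)_{p\in\mathbb N}$, $(A_p)_{p\in\mathbb N}$ be sequences of positive numbers with $M_0=M_1=A_0=A_1=1$, such that * both sequences satisfy $(M.1)$: $M_p^2\le M_{p-1}M_{p+1}$ for all $p\ge 1$, and $(M.2)$: there are $c_0,H\ge 1$ with $M_p\le c_0H^p\min_{0\le q\le p}M_{p-q}M_q$ for all $p\in\mathbb N$ (and the same with $A_p$ in place of $M_p$); * $M_p$ satisfies $(M.5)$: there are $q>0$ and $c_0\ge 1$ with $\sum_{j=p+1}^\infty M_{j-1}^q/M_j^q\le c_0\,p\,M_p^q/M_{p+1}^q$ (in particular the series converges) for all $p\ge 1$; * $A_p$ satisfies $(M.6)$: there are $c_0,L_0\ge 1$ with $p!\le c_0L_0^pA_p$ for all $p\in\mathbb N$. Let $A(\rho)=\sup_{p\in\mathbb N}\log_+(\rho^p/A_p)$, $\rho\ge 0$, and for $h>0$ let $\mathcal S^{M_p,h}_{A_p,h}$ be the space of all $\varphi\in C^\infty(\mathbb R^d)$ (complex valued) for which $$\sigma_h(\varphi)=\sup_{\alpha\in\mathbb N^d}\frac{h^{|\alpha|}\,\big\|e^{A(h|\cdot|)}D^\alpha\varphi\big\|_{L^\infty(\mathbb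 R^d)}}{M_{|\alpha|}}<\infty ,$$ normed by $\sigma_h$. Let $\mathcal S^{(M_p)}_{(A_p)}(\mathbb R^d)=\bigcap_{h>0}\mathcal S^{M_p,h}_{A_p,h}$ with the projective limit topology as $h\to\infty$ (Beurling case), and $\mathcal S^{\{M_p\}}_{\{A_p\}}(\mathbb R^d)=\bigcup_{h>0}\mathcal S^{M_p,h}_{A_p,h}$ with the locally convex inductive limit topology as $h\to 0$ (Roumieu case). A linear map $T:X\to Y$ of normed spaces is called nuclear if there are $x_n'\in X'$, $y_n\in Y$ with $\sum_n\|x_n'\|\,\|y_n\|<\infty$ and $Tx=\sum_n\langle x_n',x\rangle y_n$ for all $x\in X$. A Hausdorff locally convex space $E$ is called nuclear if for every continuous seminorm $p$ on $E$ there is a continuous seminorm $q\ge p$ such that the canonical map $\widehat E_q\to\widehat E_p$ is nuclear, where $\widehat E_p$ denotes the completion of the normed space $E/p^{-1}(0)$. Then: 1. For every $h>0$ there is $h_1>h$ such that $\mathcal S^{M_p,h_1}_{A_p,h_1}\subseteq\mathcal S^{M_p,h}_{A_p,h}$ and this inclusion is nuclear. 2. For every $h>0$ there is $0<h_1<h$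 such that $\mathcal S^{M_p,h}_{A_p,h}\subseteq\mathcal S^{M_p,h_1}_{A_p,h_1}$ and this inclusion is nuclear. 3. The spaces $\mathcal S^{(M_p)}_{(A_p)}(\mathbb R^d)$ and $\mathcal S^{\{M_p\}}_{\{A_p\}}(\mathbb R^d)$ are nuclear. 4. Their strong duals $\mathcal S'^{(M_p)}_{(A_p)}(\mathbb R^d)$ and $\mathcal S'^{\{M_p\}}_{\{A_p\}}(\mathbb R^d)$ (topology of uniform convergence on bounded sets) are nuclear. -/

import Mathlib

open scoped ContDiff

noncomputable section

namespace GelfandShilov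

/-! ### Nuclear maps and nuclear locally convex spaces -/

section Nuclear

/-- A linear map `T : X → Y` between (semi)normed spaces is nuclear if `T x = ∑ ⟨x'ₙ, x⟩ yₙ` with
`x'ₙ ∈ X'`, `yₙ ∈ Y` and `∑ ‖x'ₙ‖ ‖yₙ‖ < ∞`. -/
def IsNuclearMap {X Y : Type*} [SeminormedAddCommGroup X] [NormedSpace ℂ X]
    [SeminormedAddCommGroup Y] [NormedSpace ℂ Y] (T : X →ₗ[ℂ] Y) : Prop :=
  ∃ (x' : ℕ → StrongDual ℂ X) (y : ℕ → Y),
    Summable (fun n => ‖x' n‖ * ‖y n‖) ∧ ∀ x : X, HasSum (fun n => x' n x • y n) (T x)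

variable {E : Type*} [AddCommGroup E] [Module ℂ E]

/-- The space `E` seminormed by `p` alone. Its (Hausdorff) completion is the Banach space
`Ê_p`, the completion of the normed space `E / p⁻¹(0)`. -/
def SeminormSpace (_p : Seminorm ℂ E) : Type _ := E

instance (p : Seminorm ℂ E) : SeminormedAddCommGroup (SeminormSpace p) :=
  p.toAddGroupSeminorm.toSeminormedAddCommGroup

instance (p : Seminorm ℂ E) : Module ℂ (SeminormSpace p) :=
  inferInstanceAs (Module ℂ E)

instance (p : Seminorm ℂ E) : NormedSpace ℂ (SeminormSpace p) where
  norm_smul_le c x := (map_smul_eq_mul p c x).le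

/-- For `p ≤ q`, the identity of `E` as a continuous map `(E, q) → (E, p)`. -/
def seminormId {p q : Seminorm ℂ E} (hpq : p ≤ q) : SeminormSpace q →L[ℂ] SeminormSpace p :=
  LinearMap.mkContinuous
    { toFun := fun x : E => x, map_add' := fun _ _ => rfl, map_smul' := fun _ _ => rfl } 1
    (fun x => (hpq x).trans_eq (one_mul (q x)).symm)

/-- For `p ≤ q`, the canonical map `Ê_q → Ê_p` of Banach spaces. -/
def canonicalMap {p q : Seminorm ℂ E} (hpq : p ≤ q) :
    UniformSpace.Completion (SeminormSpace q) →L[ℂ] UniformSpace.Completion (SeminormSpace p) :=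
  (seminormId hpq).completion

/-- A nuclear space: a Hausdorff locally convex space such that for every continuous seminorm `p`
there is a continuous seminorm `q ≥ p` for which `Ê_q → Ê_p` is nuclear. -/
structure IsNuclearSpace (E : Type*) [AddCommGroup E] [Module ℂ E] [TopologicalSpace E] :
    Prop where
  isTopologicalAddGroup : IsTopologicalAddGroup E
  continuousSMul : ContinuousSMul ℂ E
  locallyConvexSpace : LocallyConvexSpace ℝ E
  t2Space : T2Space E
  nuclear : ∀ p : Seminorm ℂ E, Continuous p →
    ∃ q : Seminorm ℂ E, Continuous q ∧ ∃ hpq : p ≤ q, IsNuclearMap (canonicalMap hpq).toLinearMap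

end Nuclear

/-! ### Weight sequences -/

/-- A sequence of positive numbers with `M₀ = M₁ = 1`. -/
structure WeightSequence where
  toFun : ℕ → ℝ
  pos : ∀ p, 0 < toFun p
  map_zero : toFun 0 = 1
  map_one : toFun 1 = 1

instance : CoeFun WeightSequence (fun _ => ℕ → ℝ) := ⟨WeightSequence.toFun⟩

namespace WeightSequence

/-- `(M.1)`: logarithmic convexity. -/
def LogConvex (M : WeightSequence) : Prop :=
  ∀ p : ℕ, 1 ≤ p → M p ^ 2 ≤ M (p - 1) * M (p + 1)

/-- `(M.2)`: stability under ultradifferential operators. -/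
def Stable (M : WeightSequence) : Prop :=
  ∃ c H : ℝ, 1 ≤ c ∧ 1 ≤ H ∧ ∀ p q : ℕ, q ≤ p → M p ≤ c * H ^ p * (M (p - q) * M q)

/-- `(M.5)`: some power `M_p ^ q`, `q > 0` real, is strongly non-quasianalytic, i.e.
`∑_{j ≥ p+1} M_{j-1}^q / M_j^q ≤ c p M_p^q / M_{p+1}^q` for all `p ≥ 1`
(the sum is indexed by `j = p + 1 + k`). -/
def PowerStronglyNonQuasianalytic (M : WeightSequence) : Prop :=
  ∃ q : ℝ, 0 < q ∧ ∃ c : ℝ, 1 ≤ c ∧ ∀ p : ℕ, 1 ≤ p →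
    Summable (fun k : ℕ => M (p + k) ^ q / M (p + k + 1) ^ q) ∧
    ∑' k : ℕ, M (p + k) ^ q / M (p + k + 1) ^ q ≤ c * p * (M p ^ q / M (p + 1) ^ q)

/-- `(M.6)`: `p! ⊂ M_p`. -/
def DominatesFactorial (M : WeightSequence) : Prop :=
  ∃ c L : ℝ, 1 ≤ c ∧ 1 ≤ L ∧ ∀ p : ℕ, (p.factorial : ℝ) ≤ c * L ^ p * M p

/-- The associated function `ρ ↦ sup_p log⁺ (ρ ^ p / M_p)`. Under `(M.6)` the supremum is over a
bounded set for every `ρ ≥ 0`. -/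
def assoc (M : WeightSequence) (ρ : ℝ) : ℝ := ⨆ p : ℕ, Real.posLog (ρ ^ p / M p)

end WeightSequence

/-! ### Partial derivatives -/

/-- The partial derivative `∂ᵢ f`. -/
def partialDeriv {d : ℕ} (i : Fin d) (f : EuclideanSpace ℝ (Fin d) → ℂ) :
    EuclideanSpace ℝ (Fin d) → ℂ :=
  fun x => fderiv ℝ f x (EuclideanSpace.single i 1)

/-- `∂^α f = ∂₁^{α₁} ⋯ ∂_d^{α_d} f` for a multi-index `α`. -/
def multiDeriv {d : ℕ} (α : Fin d → ℕ) (f : EuclideanSpace ℝ (Fin d) → ℂ) :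
    EuclideanSpace ℝ (Fin d) → ℂ :=
  (List.finRange d).foldr (fun i g => (partialDeriv i)^[α i] g) f

section deriv

variable {d : ℕ} {f g : EuclideanSpace ℝ (Fin d) → ℂ}

lemma contDiff_partialDeriv (i : Fin d) (hf : ContDiff ℝ ∞ f) :
    ContDiff ℝ ∞ (partialDeriv i f) :=
  (hf.fderiv_right (m := ∞) (by simp)).clm_apply contDiff_const

lemma partialDeriv_add (i : Fin d) (hf : ContDiff ℝ ∞ f) (hg : ContDiff ℝ ∞ g) :
    partialDeriv i (f + g) = partialDeriv i f + partialDeriv i g := by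
  funext x
  simp only [partialDeriv, Pi.add_apply]
  rw [fderiv_add (hf.differentiable (by simp) x) (hg.differentiable (by simp) x)]
  rfl

lemma partialDeriv_smul (i : Fin d) (c : ℂ) (hf : ContDiff ℝ ∞ f) :
    partialDeriv i (c • f) = c • partialDeriv i f := by
  funext x
  simp only [partialDeriv, Pi.smul_apply]
  rw [fderiv_const_smul (hf.differentiable (by simp) x)]
  rfl

lemma iterate_partialDeriv (i : Fin d) (n : ℕ) (hf : ContDiff ℝ ∞ f) :
    ContDiff ℝ ∞ ((partialDeriv i)^[n] f) := by
  induction n with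
  | zero => exact hf
  | succ n ih =>
    rw [Function.iterate_succ_apply']
    exact contDiff_partialDeriv i ih

lemma iterate_partialDeriv_add (i : Fin d) (n : ℕ) (hf : ContDiff ℝ ∞ f) (hg : ContDiff ℝ ∞ g) :
    (partialDeriv i)^[n] (f + g) = (partialDeriv i)^[n] f + (partialDeriv i)^[n] g := by
  induction n with
  | zero => rfl
  | succ n ih =>
    simp only [Function.iterate_succ_apply', ih]
    exact partialDeriv_add i (iterate_partialDeriv i n hf) (iterate_partialDeriv i n hg)

lemma iterate_partialDeriv_smul (i : Fin d) (n : ℕ) (c : ℂ) (hf : ContDiff ℝ ∞ f) :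
    (partialDeriv i)^[n] (c • f) = c • (partialDeriv i)^[n] f := by
  induction n with
  | zero => rfl
  | succ n ih =>
    simp only [Function.iterate_succ_apply', ih]
    exact partialDeriv_smul i c (iterate_partialDeriv i n hf)

lemma contDiff_foldr (α : Fin d → ℕ) (l : List (Fin d)) (hf : ContDiff ℝ ∞ f) :
    ContDiff ℝ ∞ (l.foldr (fun i g => (partialDeriv i)^[α i] g) f) := by
  induction l with
  | nil => exact hf
  | cons i l ih => exact iterate_partialDeriv i (α i) ih

lemma contDiff_multiDeriv (α : Fin d → ℕ) (hf : ContDiff ℝ ∞ f) :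
    ContDiff ℝ ∞ (multiDeriv α f) :=
  contDiff_foldr α _ hf

lemma multiDeriv_add (α : Fin d → ℕ) (hf : ContDiff ℝ ∞ f) (hg : ContDiff ℝ ∞ g) :
    multiDeriv α (f + g) = multiDeriv α f + multiDeriv α g := by
  unfold multiDeriv
  induction List.finRange d with
  | nil => rfl
  | cons i l ih =>
    simp only [List.foldr_cons, ih]
    exact iterate_partialDeriv_add i (α i) (contDiff_foldr α l hf) (contDiff_foldr α l hg)

lemma multiDeriv_smul (α : Fin d → ℕ) (c : ℂ) (hf : ContDiff ℝ ∞ f) :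
    multiDeriv α (c • f) = c • multiDeriv α f := by
  unfold multiDeriv
  induction List.finRange d with
  | nil => rfl
  | cons i l ih =>
    simp only [List.foldr_cons, ih]
    exact iterate_partialDeriv_smul i (α i) c (contDiff_foldr α l hf)

lemma multiDeriv_zero_index (f : EuclideanSpace ℝ (Fin d) → ℂ) : multiDeriv 0 f = f := by
  unfold multiDeriv
  induction List.finRange d with
  | nil => rfl
  | cons i l ih => simpa using ih

end deriv

/-! ### The Banach steps -/

/-- The indices `h > 0`. -/
abbrev PosReal : Type := {h : ℝ // 0 < h}

section Step

variable (M A : WeightSequence) (d : ℕ) (h : PosReal)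

/-- `h^{|α|} e^{A(h|x|)} |D^α φ(x)| / M_{|α|}`. -/
def stepTerm {d : ℕ} (φ : EuclideanSpace ℝ (Fin d) → ℂ)
    (k : (Fin d → ℕ) × EuclideanSpace ℝ (Fin d)) : ℝ :=
  (h : ℝ) ^ (∑ i, k.1 i) * Real.exp (A.assoc (h * ‖k.2‖)) * ‖multiDeriv k.1 φ k.2‖ /
    M (∑ i, k.1 i)

variable {M A d h}

lemma stepTerm_nonneg (φ : EuclideanSpace ℝ (Fin d) → ℂ)
    (k : (Fin d → ℕ) × EuclideanSpace ℝ (Fin d)) : 0 ≤ stepTerm M A h φ k := by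
  have h1 := M.pos (∑ i, k.1 i)
  have h2 := h.2
  unfold stepTerm
  positivity

lemma stepTerm_add_le {φ ψ : EuclideanSpace ℝ (Fin d) → ℂ} (hφ : ContDiff ℝ ∞ φ)
    (hψ : ContDiff ℝ ∞ ψ) (k : (Fin d → ℕ) × EuclideanSpace ℝ (Fin d)) :
    stepTerm M A h (φ + ψ) k ≤ stepTerm M A h φ k + stepTerm M A h ψ k := by
  have h1 := M.pos (∑ i, k.1 i)
  have h2 := h.2
  unfold stepTerm
  rw [multiDeriv_add _ hφ hψ, ← add_div, ← mul_add]
  gcongr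
  exact norm_add_le _ _

lemma stepTerm_smul (c : ℂ) {φ : EuclideanSpace ℝ (Fin d) → ℂ} (hφ : ContDiff ℝ ∞ φ)
    (k : (Fin d → ℕ) × EuclideanSpace ℝ (Fin d)) :
    stepTerm M A h (c • φ) k = ‖c‖ * stepTerm M A h φ k := by
  unfold stepTerm
  rw [multiDeriv_smul _ c hφ, Pi.smul_apply, norm_smul]
  ring

variable (M A d h)

/-- The vector space of all `φ ∈ C^∞(ℝ^d)` with `σ_h(φ) < ∞`. -/
def stepSubmodule : Submodule ℂ (EuclideanSpace ℝ (Fin d) → ℂ) where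
  carrier := {φ | ContDiff ℝ ∞ φ ∧ BddAbove (Set.range (stepTerm M A h φ))}
  add_mem' := by
    rintro φ ψ ⟨hφ, a, ha⟩ ⟨hψ, b, hb⟩
    refine ⟨hφ.add hψ, a + b, ?_⟩
    rintro _ ⟨k, rfl⟩
    exact (stepTerm_add_le hφ hψ k).trans (add_le_add (ha ⟨k, rfl⟩) (hb ⟨k, rfl⟩))
  zero_mem' := by
    refine ⟨contDiff_const, 0, ?_⟩
    rintro _ ⟨k, rfl⟩
    have := stepTerm_smul (M := M) (A := A) (h := h) (0 : ℂ)
      (φ := (0 : EuclideanSpace ℝ (Fin d) → ℂ)) contDiff_const k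
    simp only [zero_smul, norm_zero, zero_mul] at this
    exact this.le
  smul_mem' := by
    rintro c φ ⟨hφ, a, ha⟩
    refine ⟨contDiff_const.smul hφ, ‖c‖ * a, ?_⟩
    rintro _ ⟨k, rfl⟩
    rw [stepTerm_smul c hφ k]
    exact mul_le_mul_of_nonneg_left (ha ⟨k, rfl⟩) (norm_nonneg c)

/-- The space `S^{M_p,h}_{A_p,h}` (a type of its own, so that it carries the norm topology and not
the topology of pointwise convergence). -/
def Step : Type := stepSubmodule M A d h

instance : AddCommGroup (Step M A d h) := inferInstanceAs (AddCommGroup (stepSubmodule M A d h))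

instance : Module ℂ (Step M A d h) := inferInstanceAs (Module ℂ (stepSubmodule M A d h))

variable {M A d h}

/-- The function underlying an element of the step. -/
def Step.fn (φ : Step M A d h) : EuclideanSpace ℝ (Fin d) → ℂ := Subtype.val φ

lemma Step.contDiff (φ : Step M A d h) : ContDiff ℝ ∞ φ.fn := (Subtype.property φ).1

lemma Step.bddAbove (φ : Step M A d h) : BddAbove (Set.range (stepTerm M A h φ.fn)) :=
  (Subtype.property φ).2

/-- The norm `σ_h(φ) = sup_α h^{|α|} ‖e^{A(h|·|)} D^α φ‖_{L^∞} / M_{|α|}`; the functions involved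
are continuous, so that the `L^∞` norm is a supremum over all points. -/
instance : Norm (Step M A d h) where
  norm φ := ⨆ k : (Fin d → ℕ) × EuclideanSpace ℝ (Fin d), stepTerm M A h φ.fn k

lemma Step.norm_def (φ : Step M A d h) :
    ‖φ‖ = ⨆ k : (Fin d → ℕ) × EuclideanSpace ℝ (Fin d), stepTerm M A h φ.fn k := rfl

lemma Step.stepTerm_le_norm (φ : Step M A d h)
    (k : (Fin d → ℕ) × EuclideanSpace ℝ (Fin d)) : stepTerm M A h φ.fn k ≤ ‖φ‖ :=
  le_ciSup φ.bddAbove k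

lemma Step.core : NormedSpace.Core ℂ (Step M A d h) where
  norm_nonneg φ := Real.iSup_nonneg fun k => stepTerm_nonneg φ.fn k
  norm_smul c φ := by
    rw [Step.norm_def, Step.norm_def, Real.mul_iSup_of_nonneg (norm_nonneg c)]
    exact iSup_congr fun k => stepTerm_smul c φ.contDiff k
  norm_triangle φ ψ :=
    ciSup_le fun k => (stepTerm_add_le φ.contDiff ψ.contDiff k).trans
      (add_le_add (φ.stepTerm_le_norm k) (ψ.stepTerm_le_norm k))
  norm_eq_zero_iff φ := by
    constructor
    · intro h0
      refine Subtype.ext (funext fun x => ?_)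
      have h1 : stepTerm M A h φ.fn (0, x) ≤ 0 := h0 ▸ φ.stepTerm_le_norm (0, x)
      have h2 : stepTerm M A h φ.fn (0, x) =
          Real.exp (A.assoc (h * ‖x‖)) * ‖φ.fn x‖ := by
        simp [stepTerm, multiDeriv_zero_index, M.map_zero]
      rw [h2] at h1
      have h3 : ‖φ.fn x‖ ≤ 0 := by
        by_contra hc
        exact absurd h1 (not_le.2 (mul_pos (Real.exp_pos _) (not_le.1 hc)))
      exact norm_le_zero_iff.1 h3
    · rintro rfl
      have h1 : ∀ k, stepTerm M A h (Step.fn (0 : Step M A d h)) k = 0 := fun k => by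
        have := stepTerm_smul (M := M) (A := A) (h := h) (0 : ℂ)
          (Step.contDiff (0 : Step M A d h)) k
        simp only [zero_smul, norm_zero, zero_mul] at this
        exact this
      rw [Step.norm_def]
      simp [h1]

instance : NormedAddCommGroup (Step M A d h) := NormedAddCommGroup.ofCore Step.core

instance : NormedSpace ℂ (Step M A d h) := NormedSpace.ofCore Step.core

/-- The inclusion of one step into another. -/
def Step.inclusion {h₁ h₂ : PosReal} (hle : stepSubmodule M A d h₁ ≤ stepSubmodule M A d h₂) :
    Step M A d h₁ →ₗ[ℂ] Step M A d h₂ :=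
  Submodule.inclusion hle

end Step

/-! ### The Beurling space -/

section Beurling

variable (M A : WeightSequence) (d : ℕ)

/-- The functions that belong to every step. -/
def beurlingSubmodule : Submodule ℂ (EuclideanSpace ℝ (Fin d) → ℂ) :=
  ⨅ h : PosReal, stepSubmodule M A d h

/-- The space `S^{(M_p)}_{(A_p)}(ℝ^d)`. -/
def Beurling : Type := beurlingSubmodule M A d

instance : AddCommGroup (Beurling M A d) :=
  inferInstanceAs (AddCommGroup (beurlingSubmodule M A d))

instance : Module ℂ (Beurling M A d) := inferInstanceAs (Module ℂ (beurlingSubmodule M A d))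

/-- The canonical map of the projective limit into the step of index `h`. -/
def Beurling.toStep (h : PosReal) : Beurling M A d →ₗ[ℂ] Step M A d h :=
  Submodule.inclusion (iInf_le (fun h : PosReal => stepSubmodule M A d h) h)

/-- The projective limit topology. -/
instance : TopologicalSpace (Beurling M A d) :=
  ⨅ h : PosReal, TopologicalSpace.induced (Beurling.toStep M A d h) inferInstance

end Beurling

/-! ### The Roumieu space -/

section Roumieu

variable (M A : WeightSequence) (d : ℕ)

/-- The union of all steps, as a supremum of subspaces (the steps form a chain when the associated
function of `A` is finite). -/
def roumieuSubmodule : Submodule ℂ (EuclideanSpace ℝ (Fin d) → ℂ) :=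
  ⨆ h : PosReal, stepSubmodule M A d h

/-- The space `S^{{M_p}}_{{A_p}}(ℝ^d)`. -/
def Roumieu : Type := roumieuSubmodule M A d

instance : AddCommGroup (Roumieu M A d) :=
  inferInstanceAs (AddCommGroup (roumieuSubmodule M A d))

instance : Module ℂ (Roumieu M A d) := inferInstanceAs (Module ℂ (roumieuSubmodule M A d))

/-- The canonical map of the step of index `h` into the inductive limit. -/
def Roumieu.ofStep (h : PosReal) : Step M A d h →ₗ[ℂ] Roumieu M A d :=
  Submodule.inclusion (le_iSup (fun h : PosReal => stepSubmodule M A d h) h)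

/-- The inductive limit topology in the category of locally convex spaces: the finest locally
convex vector space topology for which the inclusions of all steps are continuous. -/
instance : TopologicalSpace (Roumieu M A d) :=
  sInf {t : TopologicalSpace (Roumieu M A d) |
    (∀ h : PosReal, @Continuous _ _ _ t (Roumieu.ofStep M A d h)) ∧
    @IsTopologicalAddGroup (Roumieu M A d) t _ ∧
    @ContinuousSMul ℂ (Roumieu M A d) _ _ t ∧
    @LocallyConvexSpace ℝ (Roumieu M A d) _ _ _ _ t}

end Roumieu

end GelfandShilov

end

noncomputable section

namespace GelfandShilov

open Filter Topology Finset

/-! ### Orthonormal systems that may contain zeros -/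

section Orthogonal

variable {K : Type*} [NormedAddCommGroup K] [InnerProductSpace ℂ K] {v : ℕ → K}

/-! Nuclearity is reached through Hilbert–Schmidt estimates. If a Hilbertian seminorm `N` is the L²
norm of functionals `a z` with `|a z x| ≤ k z * q x` and `k` square integrable, then `N` is
two-summing with respect to `q` (`twoSumming_integral`). Two such passages in succession expand into
a nuclear series (`exists_nuclear_expansion`), and one more domination returns from the last
Hilbertian seminorm to the given one. Chains of three relations `HilbertLE` therefore suffice, both
for maps (`isNuclearMap_of_hilbertLE`) and for spaces (`IsNuclearSpace.of_hilbertLE`).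

For the steps, (M.2) for both sequences and (M.6) for `A` give a dilation `κ` of the index that pays
for any polynomial decay, for a factor `κ⁻¹ ^ |α|`, or for finitely many extra derivatives. By a
weighted Sobolev inequality, `σ_h` is at most a constant times a weighted L² norm of index `κ h`;
that norm is two-summing with respect to the norm of index `κ² h` (`Step.hilbertLE`). The norms
`σ_h` define the Beurling topology, so the Beurling space is nuclear.

The other three spaces follow by duality. If every seminorm of a sequence satisfies `HilbertLE` with
its successor, then the polar seminorms of the sets bounded for the whole sequence dominate each
other in the same way (`SeminormBounded.exists_hilbertLE`). Applied to `σ_h` along `h = c ^ n`, this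
is nuclearity of the Beurling dual. Transposes of nuclear inclusions (`IsNuclearMap.hilbertLE_dual`)
make the dual norms on the Roumieu dual such a sequence; by Hahn–Banach every continuous seminorm on
the Roumieu space is a polar, so that space is nuclear. Finally, each bounded set of the Roumieu
space is controlled by a single dual norm (`Roumieu.exists_dualNorm_bound`), so the dual norms
define the strong topology and the Roumieu dual is nuclear. -/

lemma norm_sum_sq_of_orthogonal (hv : ∀ i j, i ≠ j → inner ℂ (v i) (v j) = 0)
    (s : Finset ℕ) (c : ℕ → ℂ) :
    ‖∑ i ∈ s, c i • v i‖ ^ 2 = ∑ i ∈ s, ‖c i‖ ^ 2 * ‖v i‖ ^ 2 := by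
  classical
  induction s using Finset.induction_on with
  | empty => simp
  | insert j s hj ih =>
    have h0 : inner ℂ (c j • v j) (∑ i ∈ s, c i • v i) = 0 := by
      rw [inner_sum]
      refine Finset.sum_eq_zero fun i hi => ?_
      rw [inner_smul_left, inner_smul_right, hv j i (fun h => hj (h ▸ hi))]
      simp
    have h1 := norm_add_sq_eq_norm_sq_add_norm_sq_of_inner_eq_zero _ _ h0
    rw [Finset.sum_insert hj, Finset.sum_insert hj, ← ih, sq, h1, norm_smul]
    ring

lemma inner_self_smul_of_norm_eq (hv1 : ∀ i, v i = 0 ∨ ‖v i‖ = 1) (i : ℕ) (y : K) :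
    inner ℂ (v i) y * (‖v i‖ : ℂ) ^ 2 = inner ℂ (v i) y := by
  rcases hv1 i with h | h <;> simp [h]

lemma inner_sub_sum_of_orthogonal (hv : ∀ i j, i ≠ j → inner ℂ (v i) (v j) = 0)
    (hv1 : ∀ i, v i = 0 ∨ ‖v i‖ = 1) (y : K) {s : Finset ℕ} {j : ℕ} (hj : j ∈ s) :
    inner ℂ (v j) (y - ∑ i ∈ s, inner ℂ (v i) y • v i) = 0 := by
  rw [inner_sub_right, inner_sum, Finset.sum_eq_single j]
  · rw [inner_smul_right, inner_self_eq_norm_sq_to_K, sub_eq_zero]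
    exact (inner_self_smul_of_norm_eq hv1 j y).symm
  · intro i _ hij
    rw [inner_smul_right, hv j i hij.symm, mul_zero]
  · exact fun h => absurd hj h

/-- Pythagoras: the residual of the projection is orthogonal to every `v i` with `i ∈ s`. The choice
`c = 0` yields Bessel's inequality; general `c` says that the projection is the best approximation,
which yields totality. -/
lemma norm_sub_sum_sq_of_orthogonal (hv : ∀ i j, i ≠ j → inner ℂ (v i) (v j) = 0)
    (hv1 : ∀ i, v i = 0 ∨ ‖v i‖ = 1) (y : K) (s : Finset ℕ) (c : ℕ → ℂ) :
    ‖y - ∑ i ∈ s, c i • v i‖ ^ 2 = ‖y - ∑ i ∈ s, inner ℂ (v i) y • v i‖ ^ 2 +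
      ‖∑ i ∈ s, (inner ℂ (v i) y - c i) • v i‖ ^ 2 := by
  have h0 : inner ℂ (y - ∑ i ∈ s, inner ℂ (v i) y • v i)
      (∑ i ∈ s, (inner ℂ (v i) y - c i) • v i) = 0 := by
    rw [inner_sum]
    refine Finset.sum_eq_zero fun i hi => ?_
    rw [inner_smul_right, inner_eq_zero_symm.1 (inner_sub_sum_of_orthogonal hv hv1 y hi),
      mul_zero]
  have h1 := norm_add_sq_eq_norm_sq_add_norm_sq_of_inner_eq_zero _ _ h0
  rw [sq, sq, sq, ← h1]
  simp [sub_smul, Finset.sum_sub_distrib]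

lemma sum_norm_inner_sq_le_of_orthogonal (hv : ∀ i j, i ≠ j → inner ℂ (v i) (v j) = 0)
    (hv1 : ∀ i, v i = 0 ∨ ‖v i‖ = 1) (y : K) (s : Finset ℕ) :
    ∑ i ∈ s, ‖inner ℂ (v i) y‖ ^ 2 ≤ ‖y‖ ^ 2 := by
  have h := norm_sub_sum_sq_of_orthogonal hv hv1 y s 0
  simp only [Pi.zero_apply, zero_smul, Finset.sum_const_zero, sub_zero] at h
  rw [h, norm_sum_sq_of_orthogonal hv]
  have : ∀ i, ‖inner ℂ (v i) y‖ ^ 2 * ‖v i‖ ^ 2 = ‖inner ℂ (v i) y‖ ^ 2 := fun i => by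
    rcases hv1 i with h | h <;> simp [h]
  simp only [this]
  have := sq_nonneg ‖y - ∑ i ∈ s, inner ℂ (v i) y • v i‖
  linarith

/-- A separable inner product space has a total orthonormal sequence, up to zero terms. -/
lemma exists_total_orthogonal (K : Type*) [NormedAddCommGroup K] [InnerProductSpace ℂ K]
    [SecondCountableTopology K] : ∃ v : ℕ → K,
      (∀ i j, i ≠ j → inner ℂ (v i) (v j) = 0) ∧ (∀ i, v i = 0 ∨ ‖v i‖ = 1) ∧
      ∀ y, Tendsto (fun s : Finset ℕ => ‖y - ∑ i ∈ s, inner ℂ (v i) y • v i‖) atTop (𝓝 0) := by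
  classical
  set f : ℕ → K := TopologicalSpace.denseSeq K
  -- Gram–Schmidt of a dense sequence; `v i` is zero when `f i` depends linearly on its
  -- predecessors, hence the alternative `v i = 0 ∨ ‖v i‖ = 1`.
  set v : ℕ → K := InnerProductSpace.gramSchmidtNormed ℂ f
  have hv : ∀ i j, i ≠ j → inner ℂ (v i) (v j) = 0 := fun i j hij => by
    simp [v, InnerProductSpace.gramSchmidtNormed, InnerProductSpace.gramSchmidt_orthogonal ℂ f hij]
  have hv1 : ∀ i, v i = 0 ∨ ‖v i‖ = 1 := fun i =>
    or_iff_not_imp_left.2 InnerProductSpace.gramSchmidtNormed_unit_length'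
  refine ⟨v, hv, hv1, fun y => ?_⟩
  rw [Metric.tendsto_atTop]
  intro ε hε
  obtain ⟨n, hn⟩ := (TopologicalSpace.denseRange_denseSeq K).exists_dist_lt y hε
  have hmem : f n ∈ Submodule.span ℂ (v '' Set.Iic n) := by
    rw [InnerProductSpace.span_gramSchmidtNormed]
    exact InnerProductSpace.mem_span_gramSchmidt ℂ f le_rfl
  have hmem' : f n ∈ Submodule.span ℂ (v '' ((Finset.range (n + 1) : Finset ℕ) : Set ℕ)) := by
    convert hmem using 3
    ext i
    simp
  obtain ⟨c, hc⟩ := Submodule.mem_span_image_finset_iff_exists_fun ℂ |>.1 hmem'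
  -- Extended by zero, the coefficients of `f n` serve for every larger index set `s`.
  set c' : ℕ → ℂ := fun i => if h : i ∈ Finset.range (n + 1) then c ⟨i, h⟩ else 0
  refine ⟨Finset.range (n + 1), fun s hs => ?_⟩
  have h1 := norm_sub_sum_sq_of_orthogonal hv hv1 y s c'
  have h2 : ∑ i ∈ s, c' i • v i = f n := by
    rw [← hc, ← Finset.sum_subset hs, ← Finset.sum_coe_sort (Finset.range (n + 1))]
    · exact Finset.sum_congr rfl fun i _ => by simp only [c', dif_pos i.2]
    · intro i _ hi
      simp only [c', dif_neg hi, zero_smul]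
  rw [h2] at h1
  -- Best approximation: the projection onto the span indexed by `s` is at least as close to `y` as
  -- `f n` is.
  have h3 : ‖y - ∑ i ∈ s, inner ℂ (v i) y • v i‖ ≤ ‖y - f n‖ := by
    refine le_of_sq_le_sq ?_ (norm_nonneg _)
    rw [h1]
    exact le_add_of_nonneg_right (sq_nonneg _)
  rw [dist_zero_right, norm_norm]
  exact h3.trans_lt (by rwa [← dist_eq_norm])

end Orthogonal

/-! ### Hilbertian seminorms and two-summing domination -/

section Hilbertian

variable {E : Type*} [AddCommGroup E] [Module ℂ E]

/-- A seminorm that comes from a separable inner product space. -/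
def IsHilbertian (N : Seminorm ℂ E) : Prop :=
  ∃ (K : Type) (_ : NormedAddCommGroup K) (_ : InnerProductSpace ℂ K)
    (_ : SecondCountableTopology K) (J : E →ₗ[ℂ] K), ∀ x, N x = ‖J x‖

/-- `p` is two-summing with respect to `q`: the squares of `p` are uniformly summable along finite
systems on which `q` is dominated by the `ℓ²` norm of the coefficients. -/
def TwoSumming (p q : Seminorm ℂ E) : Prop :=
  ∃ S : ℝ, ∀ (s : Finset ℕ) (x : ℕ → E),
    (∀ c : ℕ → ℂ, q (∑ i ∈ s, c i • x i) ^ 2 ≤ ∑ i ∈ s, ‖c i‖ ^ 2) → ∑ i ∈ s, p (x i) ^ 2 ≤ S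

/-- `p` is dominated by a Hilbertian seminorm that is two-summing with respect to `q`. -/
def HilbertLE (p q : Seminorm ℂ E) : Prop :=
  ∃ N : Seminorm ℂ E, IsHilbertian N ∧ p ≤ N ∧ TwoSumming N q

/-- One-element systems bound `p` on the unit ball of `q`; homogeneity does the rest. -/
lemma TwoSumming.exists_le {p q : Seminorm ℂ E} (h : TwoSumming p q) :
    ∃ C : ℝ, 0 < C ∧ ∀ x, p x ≤ C * q x := by
  obtain ⟨S, hS⟩ := h
  have key : ∀ x, q x ≤ 1 → p x ≤ √(|S| + 1) := fun x hx => by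
    have h1 := hS {0} (fun _ => x) fun c => by
      simp only [Finset.sum_singleton, map_smul_eq_mul, mul_pow]
      exact mul_le_of_le_one_right (by positivity) (pow_le_one₀ (apply_nonneg _ _) hx)
    rw [Finset.sum_singleton] at h1
    exact Real.le_sqrt_of_sq_le (h1.trans ((le_abs_self S).trans (by linarith)))
  refine ⟨√(|S| + 1), by positivity, fun x => ?_⟩
  refine le_of_forall_pos_le_add fun ε hε => ?_
  -- Strictly larger than `q x`, so that the normalization is legitimate even if `q x = 0`; the
  -- excess costs exactly `ε` in the end.
  set t : ℝ := q x + ε / √(|S| + 1)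
  have hC : 0 < √(|S| + 1) := by positivity
  have ht : 0 < t := add_pos_of_nonneg_of_pos (apply_nonneg _ _) (by positivity)
  have h1 := key ((t : ℂ)⁻¹ • x) (by
    rw [map_smul_eq_mul, norm_inv, Complex.norm_real, Real.norm_of_nonneg ht.le,
      inv_mul_le_iff₀ ht, mul_one]
    exact le_add_of_nonneg_right (by positivity))
  rw [map_smul_eq_mul, norm_inv, Complex.norm_real, Real.norm_of_nonneg ht.le,
    inv_mul_le_iff₀ ht] at h1
  refine h1.trans (le_of_eq ?_)
  simp only [t]
  field_simp

lemma TwoSumming.mono_left {p p' q : Seminorm ℂ E} (h : TwoSumming p q) {C : ℝ}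
    (hC : ∀ x, p' x ≤ C * p x) : TwoSumming p' q := by
  obtain ⟨S, hS⟩ := h
  refine ⟨C ^ 2 * S, fun s x hx => ?_⟩
  refine le_trans ?_ (mul_le_mul_of_nonneg_left (hS s x hx) (sq_nonneg C))
  rw [Finset.mul_sum]
  refine Finset.sum_le_sum fun i _ => ?_
  rw [← mul_pow]
  exact pow_le_pow_left₀ (apply_nonneg _ _) (hC _) 2

lemma TwoSumming.mono_right {p q q' : Seminorm ℂ E} (h : TwoSumming p q) {C : ℝ} (hC0 : 0 < C)
    (hC : ∀ x, q x ≤ C * q' x) : TwoSumming p q' := by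
  obtain ⟨S, hS⟩ := h
  refine ⟨C ^ 2 * S, fun s x hx => ?_⟩
  have h1 := hS s (fun i => (C : ℂ)⁻¹ • x i) fun c => by
    refine le_trans (pow_le_pow_left₀ (apply_nonneg _ _) ?_ 2) (hx c)
    have : ∑ i ∈ s, c i • (C : ℂ)⁻¹ • x i = (C : ℂ)⁻¹ • ∑ i ∈ s, c i • x i := by
      rw [Finset.smul_sum]
      exact Finset.sum_congr rfl fun i _ => smul_comm _ _ _
    rw [this, map_smul_eq_mul, norm_inv, Complex.norm_real, Real.norm_of_nonneg hC0.le,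
      inv_mul_le_iff₀ hC0]
    exact hC _
  simp only [map_smul_eq_mul, norm_inv, Complex.norm_real, Real.norm_of_nonneg hC0.le, mul_pow,
    ← Finset.mul_sum, inv_pow] at h1
  rwa [inv_mul_le_iff₀ (by positivity)] at h1

lemma TwoSumming.comp {F : Type*} [AddCommGroup F] [Module ℂ F] {p q : Seminorm ℂ E}
    (h : TwoSumming p q) (T : F →ₗ[ℂ] E) : TwoSumming (p.comp T) (q.comp T) := by
  obtain ⟨S, hS⟩ := h
  refine ⟨S, fun s x hx => hS s (fun i => T (x i)) fun c => ?_⟩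
  simpa [Seminorm.comp_apply, map_sum] using hx c

lemma IsHilbertian.comp {F : Type*} [AddCommGroup F] [Module ℂ F] {N : Seminorm ℂ E}
    (h : IsHilbertian N) (T : F →ₗ[ℂ] E) : IsHilbertian (N.comp T) := by
  obtain ⟨K, h1, h2, h3, J, hJ⟩ := h
  exact ⟨K, h1, h2, h3, J ∘ₗ T, fun x => hJ (T x)⟩

lemma HilbertLE.comp {F : Type*} [AddCommGroup F] [Module ℂ F] {p q : Seminorm ℂ E}
    (h : HilbertLE p q) (T : F →ₗ[ℂ] E) : HilbertLE (p.comp T) (q.comp T) := by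
  obtain ⟨N, h1, h2, h3⟩ := h
  exact ⟨N.comp T, h1.comp T, fun x => h2 (T x), h3.comp T⟩

lemma IsHilbertian.smul {N : Seminorm ℂ E} (h : IsHilbertian N) (C : NNReal) :
    IsHilbertian (C • N) := by
  obtain ⟨K, h1, h2, h3, J, hJ⟩ := h
  refine ⟨K, h1, h2, h3, ((C : ℝ) : ℂ) • J, fun x => ?_⟩
  rw [LinearMap.smul_apply, norm_smul, ← hJ]
  simp [NNReal.smul_def]

lemma HilbertLE.mono {p q p' q' : Seminorm ℂ E} (h : HilbertLE p q) {C C' : ℝ}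
    (hC0 : 0 ≤ C) (hC : ∀ x, p' x ≤ C * p x) (hC0' : 0 < C') (hC' : ∀ x, q x ≤ C' * q' x) :
    HilbertLE p' q' := by
  obtain ⟨N, h1, h2, h3⟩ := h
  refine ⟨C.toNNReal • N, h1.smul _, fun x => ?_,
    (h3.mono_left (C := C) fun x => le_of_eq ?_).mono_right hC0' hC'⟩
  · refine (hC x).trans ((mul_le_mul_of_nonneg_left (h2 x) hC0).trans_eq ?_)
    simp [NNReal.smul_def, hC0]
  · simp [NNReal.smul_def, hC0]

/-- Expansion of a Hilbertian seminorm along an orthonormal sequence. -/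
lemma IsHilbertian.exists_basis {N : Seminorm ℂ E} (h : IsHilbertian N) :
    ∃ (u : ℕ → E) (e : ℕ → E →ₗ[ℂ] ℂ),
      (∀ (s : Finset ℕ) (c : ℕ → ℂ), N (∑ i ∈ s, c i • u i) ^ 2 ≤ ∑ i ∈ s, ‖c i‖ ^ 2) ∧
      (∀ x (s : Finset ℕ), ∑ i ∈ s, ‖e i x‖ ^ 2 ≤ N x ^ 2) ∧
      ∀ x, Tendsto (fun s : Finset ℕ => N (x - ∑ i ∈ s, e i x • u i)) atTop (𝓝 0) := by
  obtain ⟨K, _, _, _, J, hJ⟩ := h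
  -- The orthonormal system is taken in the range of `J`, so that its members lift to `E`. The lifts
  -- `u i` are arbitrary: all three claims see them only through `J`.
  obtain ⟨v, hv, hv1, hv2⟩ := exists_total_orthogonal (LinearMap.range J)
  choose u hu using fun i => (v i).2
  have hJs : ∀ (s : Finset ℕ) (c : ℕ → ℂ), J (∑ i ∈ s, c i • u i) =
      ((∑ i ∈ s, c i • v i : LinearMap.range J) : K) := fun s c => by
    simp [map_sum, hu]
  refine ⟨u, fun i => (innerₛₗ ℂ (v i)) ∘ₗ J.rangeRestrict, fun s c => ?_, fun x s => ?_,
    fun x => ?_⟩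
  · rw [hJ, hJs, ← Submodule.coe_norm, norm_sum_sq_of_orthogonal hv]
    refine Finset.sum_le_sum fun i _ => mul_le_of_le_one_right (by positivity) ?_
    rcases hv1 i with h | h <;> simp [h]
  · rw [hJ]
    exact sum_norm_inner_sq_le_of_orthogonal hv hv1 (J.rangeRestrict x) s
  · refine (hv2 (J.rangeRestrict x)).congr fun s => ?_
    rw [hJ, map_sub, hJs]
    rfl

end Hilbertian

end GelfandShilov

end

noncomputable section

namespace GelfandShilov

open Filter Topology Finset

/-! ### Nuclear maps from two-summing domination -/

section NuclearExpansion

variable {E : Type*} [AddCommGroup E] [Module ℂ E]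

lemma norm_sum_smul_le_sqrt_mul_sqrt (s : Finset ℕ) (a b : ℕ → ℂ) :
    ‖∑ i ∈ s, a i * b i‖ ≤ √(∑ i ∈ s, ‖a i‖ ^ 2) * √(∑ i ∈ s, ‖b i‖ ^ 2) := by
  refine (norm_sum_le _ _).trans ?_
  simp only [norm_mul]
  exact Real.sum_mul_le_sqrt_mul_sqrt _ _ _

/-- If `p` is two-summing with respect to the Hilbertian `N₁`, and `N₁` with respect to the
Hilbertian `N₂`, then the identity expands into a nuclear series from `N₂` to `p`. -/
theorem exists_nuclear_expansion {p N₁ N₂ : Seminorm ℂ E} (hN₁ : IsHilbertian N₁)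
    (hN₂ : IsHilbertian N₂) (h₁ : TwoSumming p N₁) (h₂ : TwoSumming N₁ N₂) :
    ∃ (u : ℕ → E) (e : ℕ → E →ₗ[ℂ] ℂ) (r : ℕ → ℝ), (∀ k, 0 ≤ r k) ∧
      (∀ k x, ‖e k x‖ ≤ r k * N₂ x) ∧ Summable (fun k => r k * p (u k)) ∧
      ∀ x, Tendsto (fun s : Finset ℕ => p (x - ∑ i ∈ s, e i x • u i)) atTop (𝓝 0) := by
  obtain ⟨u, e, hu, he, hue⟩ := hN₁.exists_basis
  obtain ⟨v, f, hv, hf, hvf⟩ := hN₂.exists_basis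
  obtain ⟨C₁, hC₁0, hC₁⟩ := h₁.exists_le
  obtain ⟨C₂, hC₂0, hC₂⟩ := h₂.exists_le
  obtain ⟨S₁, hS₁⟩ := h₁
  obtain ⟨S₂, hS₂⟩ := h₂
  -- Hilbert–Schmidt bound for the matrix `e k (v j)`: Bessel for `N₁` in `k`, then two-summability
  -- of `N₁` along the system `v`.
  have hdouble : ∀ s t : Finset ℕ, ∑ k ∈ s, ∑ j ∈ t, ‖e k (v j)‖ ^ 2 ≤ S₂ := fun s t => by
    rw [Finset.sum_comm]
    exact (Finset.sum_le_sum fun j _ => he (v j) s).trans (hS₂ t v (hv t))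
  have hsum : ∀ k, Summable fun j => ‖e k (v j)‖ ^ 2 := fun k =>
    summable_of_sum_le (fun j => sq_nonneg _) fun t => by simpa using hdouble {k} t
  -- `√(T k)` will bound the norm of the functional `e k` with respect to `N₂`.
  set T : ℕ → ℝ := fun k => ∑' j, ‖e k (v j)‖ ^ 2
  have hT0 : ∀ k, 0 ≤ T k := fun k => tsum_nonneg fun j => sq_nonneg _
  have hT : ∀ s : Finset ℕ, ∑ k ∈ s, T k ≤ S₂ := fun s =>
    le_of_tendsto (tendsto_finsetSum s fun k _ => (hsum k).hasSum)
      (Eventually.of_forall fun t => hdouble s t)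
  have he1 : ∀ k x, ‖e k x‖ ≤ N₁ x := fun k x => by
    have := he x {k}
    rw [Finset.sum_singleton] at this
    exact le_of_sq_le_sq this (apply_nonneg _ _)
  refine ⟨u, e, fun k => √(T k), fun k => Real.sqrt_nonneg _, fun k x => ?_, ?_, fun x => ?_⟩
  -- Cauchy–Schwarz bounds `e k` on the partial sums along `v`; the residual is bounded through `N₁
  -- ≤ C₂ * N₂` and tends to zero.
  · have key : ∀ t : Finset ℕ,
        ‖e k x‖ ≤ √(T k) * N₂ x + C₂ * N₂ (x - ∑ j ∈ t, f j x • v j) := fun t => by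
      have h1 : ‖e k (∑ j ∈ t, f j x • v j)‖ ≤ √(T k) * N₂ x := by
        simp only [map_sum, map_smul, smul_eq_mul]
        refine (norm_sum_smul_le_sqrt_mul_sqrt _ _ _).trans ?_
        rw [mul_comm]
        refine mul_le_mul (Real.sqrt_le_sqrt ((hsum k).sum_le_tsum t fun j _ => sq_nonneg _))
          (Real.sqrt_le_iff.2 ⟨apply_nonneg _ _, hf x t⟩) (Real.sqrt_nonneg _) (Real.sqrt_nonneg _)
      have h2 : e k x = e k (∑ j ∈ t, f j x • v j) + e k (x - ∑ j ∈ t, f j x • v j) := by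
        rw [← map_add, add_sub_cancel]
      rw [h2]
      exact (norm_add_le _ _).trans (add_le_add h1 ((he1 k _).trans (hC₂ _)))
    have hlim : Tendsto (fun t : Finset ℕ => √(T k) * N₂ x + C₂ * N₂ (x - ∑ j ∈ t, f j x • v j))
        atTop (𝓝 (√(T k) * N₂ x + C₂ * 0)) := ((hvf x).const_mul C₂).const_add _
    rw [mul_zero, add_zero] at hlim
    exact ge_of_tendsto' hlim key
  -- From `a * b ≤ a² + b²`: the squares of `√(T k)` sum to at most `S₂`, those of `p (u k)` to at
  -- most `S₁`.
  · refine summable_of_sum_le (c := S₂ + S₁)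
      (fun k => mul_nonneg (Real.sqrt_nonneg _) (apply_nonneg _ _)) fun s => ?_
    refine le_trans ?_ (add_le_add (hT s) (hS₁ s u (hu s)))
    rw [← Finset.sum_add_distrib]
    refine Finset.sum_le_sum fun k _ => ?_
    have h1 := Real.sq_sqrt (hT0 k)
    have h2 := sq_nonneg (√(T k) - p (u k))
    nlinarith [sq_nonneg (p (u k)), hT0 k]
  · have h := (hue x).const_mul C₁
    rw [mul_zero] at h
    exact squeeze_zero (fun s => apply_nonneg _ _) (fun s => hC₁ _) h

/-- The first two dominations provide the two Hilbert–Schmidt passages, from `N₂` to `N₁` and from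
`N₁` to the norm of `Y`; the third bounds `N₂` by the norm of `X`, so that the coefficient
functionals are continuous. -/
lemma isNuclearMap_of_hilbertLE {X Y : Type*} [SeminormedAddCommGroup X] [NormedSpace ℂ X]
    [SeminormedAddCommGroup Y] [NormedSpace ℂ Y] (T : X →ₗ[ℂ] Y) {q₁ q₂ : Seminorm ℂ X}
    (h₀ : HilbertLE ((normSeminorm ℂ Y).comp T) q₁) (h₁ : HilbertLE q₁ q₂)
    (h₂ : HilbertLE q₂ (normSeminorm ℂ X)) : IsNuclearMap T := by
  obtain ⟨N₀, -, hpN₀, hN₀⟩ := h₀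
  obtain ⟨N₁, hN₁, hqN₁, hN₁q⟩ := h₁
  obtain ⟨N₂, hN₂, hqN₂, hN₂q⟩ := h₂
  obtain ⟨C, hC0, hC⟩ := hN₂q.exists_le
  have hp : TwoSumming ((normSeminorm ℂ Y).comp T) N₁ :=
    (hN₀.mono_left (C := 1) fun x => by simpa using hpN₀ x).mono_right one_pos
      fun x => by simpa using hqN₁ x
  have h12 : TwoSumming N₁ N₂ := hN₁q.mono_right one_pos fun x => by simpa using hqN₂ x
  obtain ⟨u, e, r, hr, her, hsum, hlim⟩ := exists_nuclear_expansion hN₁ hN₂ hp h12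
  have hb : ∀ k x, ‖e k x‖ ≤ r k * C * ‖x‖ := fun k x =>
    (her k x).trans (by
      rw [mul_assoc]
      exact mul_le_mul_of_nonneg_left (hC x) (hr k))
  refine ⟨fun k => (e k).mkContinuous (r k * C) (hb k), fun k => T (u k), ?_, fun x => ?_⟩
  · refine Summable.of_nonneg_of_le (fun k => by positivity) (fun k => ?_) (hsum.mul_left C)
    rw [← mul_assoc, mul_comm C]
    exact mul_le_mul_of_nonneg_right
      ((e k).mkContinuous_norm_le (mul_nonneg (hr k) hC0.le) (hb k)) (norm_nonneg _)
  · refine tendsto_iff_norm_sub_tendsto_zero.2 ((hlim x).congr fun s => ?_)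
    rw [norm_sub_rev]
    simp [map_sub, map_sum, Seminorm.comp_apply]

/-- The functionals extend from the dense isometric image without increase of norm. The resulting
series of rank-one operators defines a continuous operator that agrees with `S` on a dense set. -/
lemma IsNuclearMap.of_dense {X Y X' Y' : Type*} [SeminormedAddCommGroup X] [NormedSpace ℂ X]
    [SeminormedAddCommGroup Y] [NormedSpace ℂ Y] [NormedAddCommGroup X'] [NormedSpace ℂ X']
    [NormedAddCommGroup Y'] [NormedSpace ℂ Y'] [CompleteSpace Y'] {T : X →L[ℂ] Y}
    (h : IsNuclearMap T.toLinearMap) (i : X →L[ℂ] X') (j : Y →L[ℂ] Y') (hi : DenseRange i)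
    (hin : ∀ x, ‖i x‖ = ‖x‖) (hjn : ∀ y, ‖j y‖ = ‖y‖) (S : X' →L[ℂ] Y')
    (hS : ∀ x, S (i x) = j (T x)) : IsNuclearMap S.toLinearMap := by
  obtain ⟨x', y, hs, hx⟩ := h
  have hiso : Isometry i := AddMonoidHomClass.isometry_of_norm i hin
  set z : ℕ → StrongDual ℂ X' := fun n => (x' n).extend i
  have hzi : ∀ n x, z n (i x) = x' n x := fun n x =>
    ContinuousLinearMap.extend_eq (x' n) hi hiso.isUniformInducing x
  have hz : ∀ n, ‖z n‖ ≤ ‖x' n‖ := fun n =>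
    (z n).opNorm_le_bound (norm_nonneg _) (isClosed_property hi
      (isClosed_le (z n).continuous.norm (continuous_const.mul continuous_norm)) fun x => by
        rw [hzi, hin]
        exact (x' n).le_opNorm x)
  have hs' : Summable fun n => ‖z n‖ * ‖j (y n)‖ :=
    Summable.of_nonneg_of_le (fun n => by positivity)
      (fun n => by
        rw [hjn]
        exact mul_le_mul_of_nonneg_right (hz n) (norm_nonneg _)) hs
  -- Absolute convergence in operator norm; completeness of `Y'` enters here.
  have hsop : Summable fun n => (z n).smulRight (j (y n)) :=
    Summable.of_norm (by simpa using hs')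
  set R : X' →L[ℂ] Y' := ∑' n, (z n).smulRight (j (y n))
  have hR : ∀ x, HasSum (fun n => z n x • j (y n)) (R x) := fun x => by
    simpa using (ContinuousLinearMap.apply ℂ Y' x).hasSum hsop.hasSum
  have hRS : R = S := by
    refine DFunLike.coe_injective (hi.equalizer R.continuous S.continuous (funext fun x => ?_))
    refine (hR (i x)).unique ?_
    have h1 := j.hasSum (hx x)
    simp only [map_smul, ← hzi] at h1
    rw [Function.comp_apply, hS]
    exact h1
  refine ⟨z, fun n => j (y n), hs', fun x => ?_⟩
  have := hR x
  rwa [hRS] at this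

lemma IsNuclearMap.completion {X Y : Type*} [SeminormedAddCommGroup X] [NormedSpace ℂ X]
    [SeminormedAddCommGroup Y] [NormedSpace ℂ Y] {T : X →L[ℂ] Y}
    (h : IsNuclearMap T.toLinearMap) : IsNuclearMap T.completion.toLinearMap :=
  h.of_dense UniformSpace.Completion.toComplL UniformSpace.Completion.toComplL
    UniformSpace.Completion.denseRange_coe UniformSpace.Completion.norm_coe
    UniformSpace.Completion.norm_coe _ fun x => by simp

/-- A Hausdorff locally convex space in which every continuous seminorm is dominated through a
Hilbertian seminorm that is two-summing with respect to a continuous seminorm is nuclear. -/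
theorem IsNuclearSpace.of_hilbertLE {E : Type*} [AddCommGroup E] [Module ℂ E] [TopologicalSpace E]
    [IsTopologicalAddGroup E] [ContinuousSMul ℂ E] [LocallyConvexSpace ℝ E] [T2Space E]
    (h : ∀ p : Seminorm ℂ E, Continuous p → ∃ q : Seminorm ℂ E, Continuous q ∧ HilbertLE p q) :
    IsNuclearSpace E := by
  refine ⟨inferInstance, inferInstance, inferInstance, inferInstance, fun p hp => ?_⟩
  obtain ⟨q₁, hq₁, h₀⟩ := h p hp
  obtain ⟨q₂, hq₂, h₁⟩ := h q₁ hq₁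
  obtain ⟨q₃, hq₃, h₂⟩ := h q₂ hq₂
  -- Adding `p` secures `p ≤ q`, which the chain of dominations gives only up to constants.
  refine ⟨p + q₃, hp.add hq₃, fun x => le_add_of_nonneg_right (apply_nonneg _ _), ?_⟩
  refine IsNuclearMap.completion ?_
  refine isNuclearMap_of_hilbertLE (X := SeminormSpace (p + q₃)) (Y := SeminormSpace p)
    _ (q₁ := q₁) (q₂ := q₂) h₀ h₁ ?_
  exact h₂.mono (C := 1) (C' := 1) zero_le_one (fun x => (one_mul _).ge) one_pos fun x => by
    rw [one_mul]
    exact le_add_of_nonneg_left (apply_nonneg p _)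

end NuclearExpansion

end GelfandShilov

end

noncomputable section

namespace GelfandShilov

open Filter Topology Finset MeasureTheory

/-! ### Hilbertian seminorms from families of functionals -/

section Functionals

variable {E : Type*} [AddCommGroup E] [Module ℂ E]

/-- The seminorm is the pullback of the L² norm under `x ↦ (z ↦ a z x)`; separability of `μ` makes
L² second countable. -/
lemma exists_isHilbertian_integral {Ω : Type} [MeasurableSpace Ω] (μ : Measure Ω) [IsSeparable μ]
    (a : Ω → E →ₗ[ℂ] ℂ) (ha : ∀ x, MemLp (fun z => a z x) 2 μ) :
    ∃ N : Seminorm ℂ E, IsHilbertian N ∧ ∀ x, N x ^ 2 = ∫ z, ‖a z x‖ ^ 2 ∂μ := by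
  have : Fact ((2 : ENNReal) ≠ ⊤) := ⟨by simp⟩
  let J : E →ₗ[ℂ] Lp ℂ 2 μ :=
    { toFun := fun x => (ha x).toLp
      map_add' := fun x y => by
        rw [← MemLp.toLp_add]
        exact MemLp.toLp_congr _ _ (Eventually.of_forall fun z => by simp)
      map_smul' := fun c x => by
        rw [RingHom.id_apply, ← MemLp.toLp_const_smul]
        exact MemLp.toLp_congr _ _ (Eventually.of_forall fun z => by simp) }
  refine ⟨(normSeminorm ℂ (Lp ℂ 2 μ)).comp J, ⟨Lp ℂ 2 μ, inferInstance, inferInstance,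
    inferInstance, J, fun x => rfl⟩, fun x => ?_⟩
  have h1 : (‖J x‖ ^ 2 : ℝ) = RCLike.re (inner ℂ (J x) (J x)) := by
    rw [inner_self_eq_norm_sq]
  have h2 : inner ℂ (J x) (J x) = ∫ z, ((‖a z x‖ ^ 2 : ℝ) : ℂ) ∂μ := by
    rw [L2.inner_def]
    refine integral_congr_ae ?_
    filter_upwards [(ha x).coeFn_toLp] with z hz
    rw [show (J x : Ω → ℂ) z = a z x from hz, inner_self_eq_norm_sq_to_K]
    simp
  rw [Seminorm.comp_apply, coe_normSeminorm, h1, h2, integral_complex_ofReal]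
  rfl

/-- Self-duality of `ℓ²`, applied for each `z`: testing the system with the conjugates of `a z (x
i)` shows that the square sum is at most `k z ^ 2`. Integration in `z` then bounds the sum of `N (x
i) ^ 2`. -/
lemma twoSumming_integral {Ω : Type} [MeasurableSpace Ω] {μ : Measure Ω}
    (a : Ω → E →ₗ[ℂ] ℂ) (ha : ∀ x, MemLp (fun z => a z x) 2 μ) {N q : Seminorm ℂ E}
    (hN : ∀ x, N x ^ 2 = ∫ z, ‖a z x‖ ^ 2 ∂μ) {k : Ω → ℝ} (hk : Integrable (fun z => k z ^ 2) μ)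
    (hak : ∀ z x, ‖a z x‖ ≤ k z * q x) : TwoSumming N q := by
  have hint : ∀ x, Integrable (fun z => ‖a z x‖ ^ 2) μ := fun x =>
    (memLp_two_iff_integrable_sq_norm (ha x).1).1 (ha x)
  refine ⟨∫ z, k z ^ 2 ∂μ, fun s x hx => ?_⟩
  simp only [hN]
  rw [← integral_finsetSum s fun i _ => hint (x i)]
  refine integral_mono (integrable_finsetSum s fun i _ => hint (x i)) hk fun z => ?_
  set R : ℝ := ∑ i ∈ s, ‖a z (x i)‖ ^ 2
  have hR0 : 0 ≤ R := Finset.sum_nonneg fun i _ => sq_nonneg _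
  -- With these coefficients `a z` takes the value `R` while `q` is at most `√R`, so `R ≤ k z * √R`.
  set c : ℕ → ℂ := fun i => (starRingEnd ℂ) (a z (x i))
  have h1 : a z (∑ i ∈ s, c i • x i) = (R : ℂ) := by
    simp only [map_sum, map_smul, smul_eq_mul, c, R, Complex.conj_mul']
    push_cast
    rfl
  have h2 : q (∑ i ∈ s, c i • x i) ^ 2 ≤ R := (hx c).trans_eq (by simp [c, R])
  have h3 : R ≤ k z * q (∑ i ∈ s, c i • x i) := by
    have := hak z (∑ i ∈ s, c i • x i)
    rwa [h1, Complex.norm_real, Real.norm_of_nonneg hR0] at this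
  change R ≤ k z ^ 2
  rcases hR0.eq_or_lt with h0 | h0
  · rw [← h0]
    exact sq_nonneg _
  · have h4 : R * R ≤ k z ^ 2 * R := by
      calc R * R ≤ (k z * q (∑ i ∈ s, c i • x i)) ^ 2 := by
            rw [← sq]
            exact pow_le_pow_left₀ hR0 h3 2
        _ = k z ^ 2 * q (∑ i ∈ s, c i • x i) ^ 2 := by ring
        _ ≤ k z ^ 2 * R := mul_le_mul_of_nonneg_left h2 (sq_nonneg _)
    exact le_of_mul_le_mul_right h4 h0

lemma memLp_count_of_summable {ι : Type} [Countable ι] [MeasurableSpace ι]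
    [DiscreteMeasurableSpace ι] {a : ι → ℂ} (ha : Summable fun i => ‖a i‖ ^ 2) :
    MemLp a 2 (Measure.count : Measure ι) :=
  (memLp_two_iff_integrable_sq_norm (measurable_of_countable a).aestronglyMeasurable).2
    (integrable_count_iff.2 (by simpa using ha.norm))

lemma integral_count_eq_tsum {ι : Type} [Countable ι] [MeasurableSpace ι]
    [DiscreteMeasurableSpace ι] {a : ι → ℝ} (ha : Summable a) :
    ∫ i, a i ∂(Measure.count : Measure ι) = ∑' i, a i := by
  rw [integral_countable (integrable_count_iff.2 ha.norm)]
  simp [Measure.real]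

lemma exists_isHilbertian_tsum {ι : Type} [Countable ι] (a : ι → E →ₗ[ℂ] ℂ)
    (ha : ∀ x, Summable fun i => ‖a i x‖ ^ 2) :
    ∃ N : Seminorm ℂ E, IsHilbertian N ∧ ∀ x, N x ^ 2 = ∑' i, ‖a i x‖ ^ 2 := by
  let _ : MeasurableSpace ι := ⊤
  obtain ⟨N, hN, h⟩ := exists_isHilbertian_integral (Measure.count : Measure ι) a
    fun x => memLp_count_of_summable (ha x)
  exact ⟨N, hN, fun x => (h x).trans (integral_count_eq_tsum (ha x))⟩

lemma twoSumming_tsum {ι : Type} [Countable ι] (a : ι → E →ₗ[ℂ] ℂ)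
    (ha : ∀ x, Summable fun i => ‖a i x‖ ^ 2) {N q : Seminorm ℂ E}
    (hN : ∀ x, N x ^ 2 = ∑' i, ‖a i x‖ ^ 2) {k : ι → ℝ} (hk : Summable fun i => k i ^ 2)
    (hak : ∀ i x, ‖a i x‖ ≤ k i * q x) : TwoSumming N q := by
  let _ : MeasurableSpace ι := ⊤
  exact twoSumming_integral (μ := Measure.count) a (fun x => memLp_count_of_summable (ha x))
    (fun x => (hN x).trans (integral_count_eq_tsum (ha x)).symm)
    (integrable_count_iff.2 hk.norm) hak

/-- Parseval: Bessel gives one inequality, convergence of the expansion the other. This writes a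
Hilbertian seminorm through functionals, so that countably many can be merged into one. -/
lemma IsHilbertian.exists_hasSum {N : Seminorm ℂ E} (h : IsHilbertian N) :
    ∃ e : ℕ → E →ₗ[ℂ] ℂ, ∀ x, HasSum (fun i => ‖e i x‖ ^ 2) (N x ^ 2) := by
  obtain ⟨u, e, hu, he, hlim⟩ := h.exists_basis
  refine ⟨e, fun x => ?_⟩
  have hs : Summable fun i => ‖e i x‖ ^ 2 := summable_of_sum_le (fun i => sq_nonneg _) (he x)
  have h1 : N x ≤ √(∑' i, ‖e i x‖ ^ 2) := by
    have h2 : ∀ s : Finset ℕ, N x ≤ N (x - ∑ i ∈ s, e i x • u i) + √(∑' i, ‖e i x‖ ^ 2) :=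
      fun s => by
        have h3 : N (∑ i ∈ s, e i x • u i) ≤ √(∑' i, ‖e i x‖ ^ 2) :=
          Real.le_sqrt_of_sq_le ((hu s fun i => e i x).trans (hs.sum_le_tsum s fun i _ =>
            sq_nonneg _))
        calc N x = N ((x - ∑ i ∈ s, e i x • u i) + ∑ i ∈ s, e i x • u i) := by
              rw [sub_add_cancel]
          _ ≤ _ := (map_add_le_add N _ _).trans (by gcongr)
    have h4 := (hlim x).add_const (√(∑' i, ‖e i x‖ ^ 2))
    rw [zero_add] at h4
    exact ge_of_tendsto' h4 h2
  have h5 : ∑' i, ‖e i x‖ ^ 2 = N x ^ 2 := by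
    refine le_antisymm (hs.tsum_le_of_sum_le (he x)) ?_
    rw [← Real.sq_sqrt (tsum_nonneg fun i => sq_nonneg ‖e i x‖)]
    exact pow_le_pow_left₀ (apply_nonneg _ _) h1 2
  rw [← h5]
  exact hs.hasSum

end Functionals

/-! ### Polar seminorms and duality -/

section Duality

variable {E F : Type*} [AddCommGroup E] [Module ℂ E] [AddCommGroup F] [Module ℂ F]

/-- The seminorm `x ↦ sup_{f ∈ S} |⟨x, f⟩|` (for pointwise bounded `S`). -/
def polarSeminorm (B : E →ₗ[ℂ] F →ₗ[ℂ] ℂ) (S : Set F) : Seminorm ℂ E :=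
  ⨆ f : S, (normSeminorm ℂ ℂ).comp (B.flip f)

/-- The set `S` is pointwise bounded under the pairing `B`. -/
def PointwiseBounded (B : E →ₗ[ℂ] F →ₗ[ℂ] ℂ) (S : Set F) : Prop :=
  ∀ x, ∃ C : ℝ, ∀ f ∈ S, ‖B x f‖ ≤ C

variable {B : E →ₗ[ℂ] F →ₗ[ℂ] ℂ} {S : Set F}

lemma PointwiseBounded.bddAbove (h : PointwiseBounded B S) :
    BddAbove (Set.range fun f : S => (normSeminorm ℂ ℂ).comp (B.flip f)) := by
  rw [Seminorm.bddAbove_range_iff]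
  intro x
  obtain ⟨C, hC⟩ := h x
  refine ⟨C, ?_⟩
  rintro _ ⟨f, rfl⟩
  exact hC f f.2

lemma PointwiseBounded.le_polarSeminorm (h : PointwiseBounded B S) {f : F} (hf : f ∈ S) (x : E) :
    ‖B x f‖ ≤ polarSeminorm B S x := by
  have := le_ciSup h.bddAbove (⟨f, hf⟩ : S) x
  exact this

lemma PointwiseBounded.polarSeminorm_le (h : PointwiseBounded B S) {x : E} {C : ℝ} (hC0 : 0 ≤ C)
    (hC : ∀ f ∈ S, ‖B x f‖ ≤ C) : polarSeminorm B S x ≤ C := by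
  rw [polarSeminorm, Seminorm.iSup_apply h.bddAbove]
  exact Real.iSup_le (fun f => hC f f.2) hC0

/-- The unit ball of the weighted Hilbert sum `(∑ wₙ Nₙ²)^{1/2}`. -/
def weightedBall (N : ℕ → Seminorm ℂ F) (w : ℕ → ℝ) : Set F :=
  {f | ∀ s : Finset ℕ, ∑ n ∈ s, w n * N n f ^ 2 ≤ 1}

lemma le_of_mem_weightedBall {N : ℕ → Seminorm ℂ F} {w : ℕ → ℝ} (hw : ∀ n, 0 < w n) {f : F}
    (hf : f ∈ weightedBall N w) (n : ℕ) : N n f ≤ √(w n)⁻¹ := by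
  have := hf {n}
  rw [Finset.sum_singleton] at this
  refine Real.le_sqrt_of_sq_le ?_
  rw [← one_div, le_div_iff₀ (hw n)]
  linarith

lemma pointwiseBounded_weightedBall {N : ℕ → Seminorm ℂ F} {w : ℕ → ℝ} (hw : ∀ n, 0 < w n)
    (hB : ∀ x, ∃ (n : ℕ) (C : ℝ), 0 ≤ C ∧ ∀ f, ‖B x f‖ ≤ C * N n f) :
    PointwiseBounded B (weightedBall N w) := fun x => by
  obtain ⟨n, C, hC0, hC⟩ := hB x
  exact ⟨C * √(w n)⁻¹, fun f hf => (hC f).trans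
    (mul_le_mul_of_nonneg_left (le_of_mem_weightedBall hw hf n) hC0)⟩

/-- For `t > √b` the vector `t⁻¹ • f` lies in the ball; then `t` decreases to `√b`. The detour
through strict inequality covers `√b = 0`. -/
lemma norm_le_sqrt_mul_polarSeminorm {N : ℕ → Seminorm ℂ F} {w : ℕ → ℝ}
    (hb : PointwiseBounded B (weightedBall N w)) {f : F} {b : ℝ}
    (hf : ∀ s : Finset ℕ, ∑ n ∈ s, w n * N n f ^ 2 ≤ b) (x : E) :
    ‖B x f‖ ≤ √b * polarSeminorm B (weightedBall N w) x := by
  have key : ∀ t : ℝ, √b < t → ‖B x f‖ ≤ t * polarSeminorm B (weightedBall N w) x := fun t ht => by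
    have ht0 : 0 < t := (Real.sqrt_nonneg b).trans_lt ht
    have hmem : (t : ℂ)⁻¹ • f ∈ weightedBall N w := fun s => by
      have h1 : ∀ n, w n * N n ((t : ℂ)⁻¹ • f) ^ 2 = (t ^ 2)⁻¹ * (w n * N n f ^ 2) := fun n => by
        rw [map_smul_eq_mul, norm_inv, Complex.norm_real, Real.norm_of_nonneg ht0.le]
        ring
      simp only [h1]
      rw [← Finset.mul_sum, inv_mul_le_iff₀ (by positivity), mul_one]
      exact (hf s).trans ((Real.sqrt_le_left ht0.le).1 ht.le)
    have h2 := hb.le_polarSeminorm hmem x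
    rwa [map_smul, norm_smul, norm_inv, Complex.norm_real, Real.norm_of_nonneg ht0.le,
      inv_mul_le_iff₀ ht0] at h2
  have hcont : Tendsto (fun t : ℝ => t * polarSeminorm B (weightedBall N w) x) (𝓝[>] √b)
      (𝓝 (√b * polarSeminorm B (weightedBall N w) x)) :=
    (tendsto_id.mono_left nhdsWithin_le_nhds).mul_const _
  exact ge_of_tendsto hcont (eventually_nhdsWithin_of_forall key)

/-- The subspace on which the weighted Hilbert sum `∑ wₙ Nₙ²` is finite. -/
def weightedSubmodule (N : ℕ → Seminorm ℂ F) (w : ℕ → ℝ) (hw : ∀ n, 0 < w n) :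
    Submodule ℂ F where
  carrier := {f | Summable fun n => w n * N n f ^ 2}
  add_mem' := by
    intro f g hf hg
    refine Summable.of_nonneg_of_le (fun n => mul_nonneg (hw n).le (sq_nonneg _)) (fun n => ?_)
      ((hf.add hg).mul_left 2)
    rw [← mul_add, mul_left_comm]
    refine mul_le_mul_of_nonneg_left ?_ (hw n).le
    have h1 := map_add_le_add (N n) f g
    have h2 : N n (f + g) ^ 2 ≤ (N n f + N n g) ^ 2 := pow_le_pow_left₀ (apply_nonneg _ _) h1 2
    nlinarith [sq_nonneg (N n f - N n g)]
  zero_mem' := by simp [summable_zero]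
  smul_mem' := by
    intro c f hf
    refine (Summable.mul_left (‖c‖ ^ 2) hf).congr fun n => ?_
    rw [map_smul_eq_mul]
    ring

/-- Parseval expansions of all `N n`, weighted by `√(w n)`, form one countable family of
functionals, square summable exactly where the weighted sum is finite. -/
lemma exists_isHilbertian_weighted {N : ℕ → Seminorm ℂ F} (hN : ∀ n, IsHilbertian (N n))
    {w : ℕ → ℝ} (hw : ∀ n, 0 < w n) :
    ∃ Q : Seminorm ℂ (weightedSubmodule N w hw), IsHilbertian Q ∧
      ∀ f, Q f ^ 2 = ∑' n, w n * N n f ^ 2 := by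
  choose e he using fun n => (hN n).exists_hasSum
  set G := weightedSubmodule N w hw
  set a : ℕ × ℕ → G →ₗ[ℂ] ℂ := fun k => ((√(w k.1) : ℝ) : ℂ) • (e k.1 k.2 ∘ₗ G.subtype)
  have ha : ∀ n k (f : G), ‖a (n, k) f‖ ^ 2 = w n * ‖e n k f‖ ^ 2 := fun n k f => by
    simp only [a, LinearMap.smul_apply, norm_smul, mul_pow, Complex.norm_real, Real.norm_eq_abs,
      sq_abs, Real.sq_sqrt (hw n).le]
    rfl
  have hsum : ∀ n (f : G), HasSum (fun k => ‖a (n, k) f‖ ^ 2) (w n * N n f ^ 2) := fun n f => by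
    simp only [ha]
    exact (he n f).mul_left _
  have hs : ∀ f : G, Summable fun k => ‖a k f‖ ^ 2 := fun f => by
    rw [summable_prod_of_nonneg fun _ => sq_nonneg _]
    refine ⟨fun n => (hsum n f).summable, ?_⟩
    simp only [(hsum _ f).tsum_eq]
    exact f.2
  obtain ⟨Q, hQ, hQa⟩ := exists_isHilbertian_tsum a hs
  refine ⟨Q, hQ, fun f => ?_⟩
  rw [hQa, (hs f).tsum_prod' fun n => (hsum n f).summable]
  exact tsum_congr fun n => (hsum n f).tsum_eq

/-- Duality: if each Hilbertian seminorm `Nₙ` is two-summing with respect to `Nₙ₊₁`, then the polar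
seminorms of the balls of weighted Hilbert sums dominate each other through Hilbertian seminorms. -/
theorem exists_hilbertLE_polarSeminorm {N : ℕ → Seminorm ℂ F} (hN : ∀ n, IsHilbertian (N n))
    (hNs : ∀ n, TwoSumming (N n) (N (n + 1)))
    (hB : ∀ x, ∃ (n : ℕ) (C : ℝ), 0 ≤ C ∧ ∀ f, ‖B x f‖ ≤ C * N n f)
    {w : ℕ → ℝ} (hw : ∀ n, 0 < w n) :
    ∃ w' : ℕ → ℝ, (∀ n, 0 < w' n) ∧
      HilbertLE (polarSeminorm B (weightedBall N w)) (polarSeminorm B (weightedBall N w')) := by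
  set G := weightedSubmodule N w hw
  obtain ⟨Q, hQ, hQN⟩ := exists_isHilbertian_weighted hN hw
  have hQle : ∀ n (f : G), N n f ≤ √(w n)⁻¹ * Q f := fun n f => by
    refine le_of_sq_le_sq ?_ (by positivity)
    rw [mul_pow, Real.sq_sqrt (inv_nonneg.2 (hw n).le), hQN, ← div_eq_inv_mul, le_div_iff₀ (hw n),
      mul_comm]
    exact f.2.le_tsum n fun j _ => mul_nonneg (hw j).le (sq_nonneg _)
  -- On `G` the next seminorm `N (n + 1)` is at most a multiple of `Q`, so each `N n` is two-summing
  -- with respect to the single seminorm `Q`.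
  have hsumm : ∀ n, TwoSumming ((N n).comp G.subtype) Q := fun n =>
    ((hNs n).comp G.subtype).mono_right (Real.sqrt_pos.2 (inv_pos.2 (hw (n + 1))))
      fun f => hQle (n + 1) f
  obtain ⟨u, e, hu, he, hue⟩ := hQ.exists_basis
  choose S hS using hsumm
  have hSu : ∀ n (s : Finset ℕ), ∑ k ∈ s, N n (u k) ^ 2 ≤ S n := fun n s => hS n s u (hu s)
  -- Chosen so that the bounds `S n` of the individual square sums, multiplied by `w' n`, add up to
  -- at most `1`.
  set w' : ℕ → ℝ := fun n => (1 / 2) ^ (n + 1) / (|S n| + 1)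
  have hw' : ∀ n, 0 < w' n := fun n => by positivity
  have hgeo : ∀ t : Finset ℕ, ∑ n ∈ t, (1 / 2 : ℝ) ^ (n + 1) ≤ 1 := fun t => by
    have h1 : HasSum (fun n : ℕ => (1 / 2 : ℝ) ^ (n + 1)) 1 := by
      simpa [pow_succ] using hasSum_geometric_two.mul_right (1 / 2 : ℝ)
    exact sum_le_hasSum t (fun n _ => by positivity) h1
  have hdouble : ∀ s t : Finset ℕ, ∑ k ∈ s, ∑ n ∈ t, w' n * N n (u k) ^ 2 ≤ 1 := fun s t => by
    rw [Finset.sum_comm]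
    refine (Finset.sum_le_sum fun n _ => ?_).trans (hgeo t)
    rw [← Finset.mul_sum]
    have h1 : ∑ k ∈ s, N n (u k) ^ 2 ≤ |S n| + 1 :=
      (hSu n s).trans ((le_abs_self _).trans (by linarith))
    calc w' n * ∑ k ∈ s, N n (u k) ^ 2 ≤ w' n * (|S n| + 1) :=
          mul_le_mul_of_nonneg_left h1 (hw' n).le
      _ = _ := div_mul_cancel₀ _ (by positivity)
  have hTs : ∀ k, Summable fun n => w' n * N n (u k) ^ 2 := fun k =>
    summable_of_sum_le (fun n => mul_nonneg (hw' n).le (sq_nonneg _)) fun t => by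
      simpa using hdouble {k} t
  set T : ℕ → ℝ := fun k => ∑' n, w' n * N n (u k) ^ 2
  have hT0 : ∀ k, 0 ≤ T k := fun k => tsum_nonneg fun n => mul_nonneg (hw' n).le (sq_nonneg _)
  have hTsum : Summable T := summable_of_sum_le hT0 fun s =>
    le_of_tendsto (tendsto_finsetSum s fun k _ => (hTs k).hasSum)
      (Eventually.of_forall fun t => hdouble s t)
  have hb := pointwiseBounded_weightedBall hw hB
  have hb' := pointwiseBounded_weightedBall hw' hB
  set a : ℕ → E →ₗ[ℂ] ℂ := fun k => B.flip (u k)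
  -- `u k` lies in the `w'`-ball up to the factor `√(T k)`, and these factors are square summable;
  -- hence evaluation at the `u k` gives a Hilbertian seminorm two-summing for the new polar.
  have hak : ∀ k x, ‖a k x‖ ≤ √(T k) * polarSeminorm B (weightedBall N w') x := fun k x =>
    norm_le_sqrt_mul_polarSeminorm hb'
      (fun s => (hTs k).sum_le_tsum s fun n _ => mul_nonneg (hw' n).le (sq_nonneg _)) x
  have hks : Summable fun k => √(T k) ^ 2 := by
    simpa only [Real.sq_sqrt (hT0 _)] using hTsum
  have has : ∀ x, Summable fun k => ‖a k x‖ ^ 2 := fun x => by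
    refine Summable.of_nonneg_of_le (fun k => sq_nonneg _) (fun k => ?_)
      (hks.mul_right (polarSeminorm B (weightedBall N w') x ^ 2))
    rw [← mul_pow]
    exact pow_le_pow_left₀ (norm_nonneg _) (hak k x) 2
  obtain ⟨R, hR, hRa⟩ := exists_isHilbertian_tsum a has
  refine ⟨w', hw', R, hR, fun x => ?_, twoSumming_tsum a has hRa hks hak⟩
  refine hb.polarSeminorm_le (apply_nonneg _ _) fun f hf => ?_
  obtain ⟨n, C, hC0, hC⟩ := hB x
  have hfs : Summable fun n => w n * N n f ^ 2 :=
    summable_of_sum_le (fun n => mul_nonneg (hw n).le (sq_nonneg _)) hf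
  set g : G := ⟨f, hfs⟩
  have hg1 : Q g ^ 2 ≤ 1 := by
    rw [hQN]
    exact hfs.tsum_le_of_sum_le hf
  -- An element of the `w`-ball has coefficients of `ℓ²` norm at most `1` along `u`, so
  -- Cauchy–Schwarz bounds the pairing by `R x` up to a residual that tends to zero.
  have key : ∀ s : Finset ℕ,
      ‖B x f‖ ≤ R x + C * √(w n)⁻¹ * Q (g - ∑ i ∈ s, e i g • u i) := fun s => by
    have h1 : ‖B x (∑ i ∈ s, e i g • (u i : F))‖ ≤ R x := by
      simp only [map_sum, map_smul, smul_eq_mul]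
      refine (norm_sum_smul_le_sqrt_mul_sqrt s (fun i => e i g) fun i => B x (u i)).trans ?_
      have h2 : √(∑ i ∈ s, ‖e i g‖ ^ 2) ≤ 1 := by
        rw [Real.sqrt_le_one]
        exact (he g s).trans hg1
      have h3 : √(∑ i ∈ s, ‖B x (u i)‖ ^ 2) ≤ R x := by
        refine Real.sqrt_le_iff.2 ⟨apply_nonneg _ _, ?_⟩
        rw [hRa]
        exact (has x).sum_le_tsum s fun i _ => sq_nonneg _
      exact (mul_le_mul h2 h3 (Real.sqrt_nonneg _) zero_le_one).trans_eq (one_mul _)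
    have h4 : B x f = B x (∑ i ∈ s, e i g • (u i : F)) +
        B x ((g - ∑ i ∈ s, e i g • u i : G) : F) := by
      rw [← map_add]
      congr 1
      simp [g]
    rw [h4]
    refine (norm_add_le _ _).trans (add_le_add h1 ((hC _).trans ?_))
    rw [mul_assoc]
    exact mul_le_mul_of_nonneg_left (hQle n _) hC0
  have hlim := ((hue g).const_mul (C * √(w n)⁻¹)).const_add (R x)
  rw [mul_zero, add_zero] at hlim
  exact ge_of_tendsto' hlim key

end Duality

end GelfandShilov

end

noncomputable section

namespace GelfandShilov

open Filter Topology Finset MeasureTheory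

/-! ### The associated function -/

namespace WeightSequence

variable {A M : WeightSequence}

/-- By (M.6), `ρ ^ p / A p` is at most `c` times the term `(L ρ) ^ p / p!` of an exponential series.
-/
lemma bddAbove_assoc (hA : A.DominatesFactorial) {ρ : ℝ} (hρ : 0 ≤ ρ) :
    BddAbove (Set.range fun p : ℕ => Real.posLog (ρ ^ p / A p)) := by
  obtain ⟨c, L, hc, hL, h⟩ := hA
  refine ⟨Real.posLog (c * Real.exp (L * ρ)), ?_⟩
  rintro _ ⟨p, rfl⟩
  have hp := A.pos p
  refine Real.posLog_le_posLog (by positivity) ?_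
  have h1 : (L * ρ) ^ p / p.factorial ≤ Real.exp (L * ρ) :=
    Real.pow_div_factorial_le_exp _ (by positivity) p
  calc ρ ^ p / A p = p.factorial * ρ ^ p / (p.factorial * A p) := by
        rw [mul_div_mul_left _ _ (by positivity)]
    _ ≤ c * L ^ p * A p * ρ ^ p / (p.factorial * A p) := by
        gcongr
        exact h p
    _ = c * ((L * ρ) ^ p / p.factorial) := by
        rw [mul_pow]
        field_simp
    _ ≤ _ := by gcongr

lemma assoc_nonneg (ρ : ℝ) : 0 ≤ A.assoc ρ := Real.iSup_nonneg fun _ => Real.posLog_nonneg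

lemma one_le_exp_assoc (ρ : ℝ) : 1 ≤ Real.exp (A.assoc ρ) := Real.one_le_exp (assoc_nonneg ρ)

lemma pow_div_le_exp_assoc (hA : A.DominatesFactorial) {ρ : ℝ} (hρ : 0 ≤ ρ) (p : ℕ) :
    ρ ^ p / A p ≤ Real.exp (A.assoc ρ) := by
  have h1 : Real.posLog (ρ ^ p / A p) ≤ A.assoc ρ := le_ciSup (bddAbove_assoc hA hρ) p
  have hp := A.pos p
  rcases (show 0 ≤ ρ ^ p / A p by positivity).eq_or_lt with h | h
  · rw [← h]
    exact (Real.exp_pos _).le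
  · rw [← Real.log_le_iff_le_exp h]
    exact (le_max_right 0 _).trans h1

/-- Since `A 0 = 1`, the term `p = 0` already gives `t ≤ C`, so the truncation in `log⁺` costs
nothing. -/
lemma exp_assoc_mul_le {ρ : ℝ} (hρ : 0 ≤ ρ) {t C : ℝ} (ht : 0 ≤ t)
    (h : ∀ p, ρ ^ p / A p * t ≤ C) : Real.exp (A.assoc ρ) * t ≤ C := by
  have h0 := h 0
  rw [pow_zero, A.map_zero, div_one, one_mul] at h0
  rcases ht.eq_or_lt with rfl | ht
  · rwa [mul_zero]
  have h1 : 1 ≤ C / t := (one_le_div ht).2 h0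
  rw [← le_div_iff₀ ht, ← Real.le_log_iff_exp_le (by linarith)]
  refine ciSup_le fun p => max_le (Real.log_nonneg h1) ?_
  have hp := A.pos p
  rcases (show 0 ≤ ρ ^ p / A p by positivity).eq_or_lt with h2 | h2
  · rw [← h2, Real.log_zero]
    exact Real.log_nonneg h1
  · exact Real.log_le_log h2 ((le_div_iff₀ ht).2 (h p))

lemma assoc_mono (hA : A.DominatesFactorial) {ρ σ : ℝ} (hρ : 0 ≤ ρ) (h : ρ ≤ σ) :
    A.assoc ρ ≤ A.assoc σ :=
  ciSup_mono (bddAbove_assoc hA (hρ.trans h)) fun p => by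
    have hp := A.pos p
    exact Real.posLog_le_posLog (by positivity) (by gcongr)

lemma measurable_assoc : Measurable A.assoc :=
  Measurable.iSup fun p => by
    unfold Real.posLog
    fun_prop

/-- (M.2) bounds the product of the terms of orders `p` and `q` by `c` times the term of order `p +
q` at `H ρ`; suprema over `q` and then `p` conclude. -/
lemma exists_exp_assoc_mul_self_le (hA : A.Stable) (hA6 : A.DominatesFactorial) :
    ∃ c H : ℝ, 0 < c ∧ 1 ≤ H ∧ ∀ ρ, 0 ≤ ρ →
      Real.exp (A.assoc ρ) * Real.exp (A.assoc ρ) ≤ c * Real.exp (A.assoc (H * ρ)) := by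
  obtain ⟨c, H, hc, hH, h⟩ := hA
  refine ⟨c, H, by linarith, hH, fun ρ hρ => exp_assoc_mul_le hρ (Real.exp_pos _).le fun p => ?_⟩
  rw [mul_comm]
  have hp := A.pos p
  refine exp_assoc_mul_le hρ (by positivity) fun q => ?_
  have hq := A.pos q
  have hpq := A.pos (p + q)
  have h1 := h (p + q) q (Nat.le_add_left _ _)
  rw [Nat.add_sub_cancel] at h1
  have h2 := pow_div_le_exp_assoc hA6 (show 0 ≤ H * ρ by positivity) (p + q)
  calc ρ ^ q / A q * (ρ ^ p / A p) = ρ ^ (p + q) * A (p + q) / (A p * A q) / A (p + q) := by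
        rw [pow_add]
        field_simp
    _ ≤ ρ ^ (p + q) * (c * H ^ (p + q) * (A p * A q)) / (A p * A q) / A (p + q) := by gcongr
    _ = c * ((H * ρ) ^ (p + q) / A (p + q)) := by
        rw [mul_pow]
        field_simp
    _ ≤ _ := by gcongr

/-- `κ` is a dilation factor that gains any power in the decay, any finite number of derivatives,
and a geometric factor. -/
structure IsGain (M A : WeightSequence) (κ : ℝ) : Prop where
  two_le : 2 ≤ κ
  decay : ∀ (h : PosReal) (m : ℕ), ∃ C : ℝ, 0 < C ∧ ∀ ρ, 0 ≤ ρ →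
    Real.exp (A.assoc (h * ρ)) * (1 + ρ) ^ m ≤ C * Real.exp (A.assoc (κ * h * ρ))
  deriv : ∀ m : ℕ, ∃ C : ℝ, 0 < C ∧ ∀ n, M (n + m) ≤ C * κ ^ n * M n

lemma exists_isGain (hM2 : M.Stable) (hA2 : A.Stable) (hA6 : A.DominatesFactorial) :
    ∃ κ, IsGain M A κ := by
  obtain ⟨c, H, hc, hH, hd⟩ := exists_exp_assoc_mul_self_le hA2 hA6
  obtain ⟨c', H', hc', hH', hM⟩ := hM2
  -- The summand `2` makes `κ⁻¹ ≤ 1/2` for the geometric sums, `H` pays for squaring `e^A`, and `H'`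
  -- for shifting the order of `M`.
  refine ⟨2 + H + H', by linarith, fun h m => ?_, fun m => ?_⟩
  · have hm := A.pos m
    have hh := h.2
    refine ⟨c * ((1 + (h : ℝ)⁻¹) ^ m * 2 ^ m * (1 + A m)), by positivity, fun ρ hρ => ?_⟩
    have hhρ : 0 ≤ (h : ℝ) * ρ := by positivity
    -- One factor `e^{A(hρ)}` absorbs the polynomial because `(hρ) ^ m ≤ A m * e^{A(hρ)}`; its
    -- square is then traded for the dilation by `H`.
    have h1 : (1 + ρ) ^ m ≤ (1 + (h : ℝ)⁻¹) ^ m * 2 ^ m * (1 + A m) *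
        Real.exp (A.assoc (h * ρ)) := by
      have h2 : 1 + ρ ≤ (1 + (h : ℝ)⁻¹) * (1 + h * ρ) := by
        have : (h : ℝ)⁻¹ * (h * ρ) = ρ := by field_simp
        have h3 : (1 + (h : ℝ)⁻¹) * (1 + h * ρ) = 1 + h * ρ + (h : ℝ)⁻¹ + ρ := by
          rw [← this]; ring_nf; field_simp; ring
        rw [h3]
        have : 0 < (h : ℝ)⁻¹ := by positivity
        linarith
      have h4 : (1 + h * ρ) ^ m ≤ 2 ^ m * ((1 + A m) * Real.exp (A.assoc (h * ρ))) := by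
        have h5 := pow_div_le_exp_assoc hA6 hhρ m
        rw [div_le_iff₀ hm] at h5
        have h6 := one_le_exp_assoc (A := A) (h * ρ)
        have h7 : (1 + h * ρ) ^ m ≤ (2 * max 1 (h * ρ)) ^ m := by
          gcongr
          rw [two_mul]
          exact add_le_add (le_max_left _ _) (le_max_right _ _)
        refine h7.trans ?_
        rw [mul_pow]
        gcongr
        rcases le_total 1 ((h : ℝ) * ρ) with h8 | h8
        · rw [max_eq_right h8]
          nlinarith
        · rw [max_eq_left h8, one_pow]
          nlinarith
      calc (1 + ρ) ^ m ≤ ((1 + (h : ℝ)⁻¹) * (1 + h * ρ)) ^ m := by gcongr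
        _ = (1 + (h : ℝ)⁻¹) ^ m * (1 + h * ρ) ^ m := mul_pow _ _ _
        _ ≤ (1 + (h : ℝ)⁻¹) ^ m * (2 ^ m * ((1 + A m) * Real.exp (A.assoc (h * ρ)))) := by gcongr
        _ = _ := by ring
    set K : ℝ := (1 + (h : ℝ)⁻¹) ^ m * 2 ^ m * (1 + A m)
    have hK : 0 ≤ K := by positivity
    have h9 : A.assoc (H * (h * ρ)) ≤ A.assoc ((2 + H + H') * h * ρ) := by
      refine assoc_mono hA6 (by positivity) ?_
      rw [mul_assoc (2 + H + H')]
      exact mul_le_mul_of_nonneg_right (by linarith) hhρ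
    calc Real.exp (A.assoc (h * ρ)) * (1 + ρ) ^ m
        ≤ Real.exp (A.assoc (h * ρ)) * (K * Real.exp (A.assoc (h * ρ))) := by gcongr
      _ = K * (Real.exp (A.assoc (h * ρ)) * Real.exp (A.assoc (h * ρ))) := by ring
      _ ≤ K * (c * Real.exp (A.assoc (H * (h * ρ)))) :=
          mul_le_mul_of_nonneg_left (hd _ hhρ) hK
      _ ≤ K * (c * Real.exp (A.assoc ((2 + H + H') * h * ρ))) := by gcongr
      _ = _ := by ring
  · have hm := M.pos m
    refine ⟨c' * H' ^ m * M m, by positivity, fun n => ?_⟩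
    have hn := M.pos n
    have h1 := hM (n + m) m (Nat.le_add_left _ _)
    rw [Nat.add_sub_cancel] at h1
    calc M (n + m) ≤ c' * H' ^ (n + m) * (M n * M m) := h1
      _ = c' * H' ^ m * M m * H' ^ n * M n := by ring
      _ ≤ _ := by
        gcongr
        linarith

lemma IsGain.pos {κ : ℝ} (h : IsGain M A κ) : 0 < κ := by linarith [h.two_le]

end WeightSequence

/-! ### Multi-index derivatives -/

section MultiDeriv

variable {d : ℕ} {f : EuclideanSpace ℝ (Fin d) → ℂ}

lemma partialDeriv_comm (hf : ContDiff ℝ ∞ f) (i j : Fin d) :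
    partialDeriv i (partialDeriv j f) = partialDeriv j (partialDeriv i f) := by
  have hd : Differentiable ℝ (fderiv ℝ f) :=
    (hf.fderiv_right (m := ∞) (by simp)).differentiable (by simp)
  have key : ∀ (i j : Fin d) x, partialDeriv i (partialDeriv j f) x =
      fderiv ℝ (fderiv ℝ f) x (EuclideanSpace.single i 1) (EuclideanSpace.single j 1) := by
    intro i j x
    unfold partialDeriv
    rw [fderiv_clm_apply (hd x) (differentiableAt_const _)]
    simp
  funext x
  rw [key, key]
  exact (hf.contDiffAt.isSymmSndFDerivAt (by simp; exact WithTop.coe_le_coe.2 le_top)) _ _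

lemma partialDeriv_iterate_comm (hf : ContDiff ℝ ∞ f) (i j : Fin d) (n : ℕ) :
    partialDeriv i ((partialDeriv j)^[n] f) = (partialDeriv j)^[n] (partialDeriv i f) := by
  induction n with
  | zero => rfl
  | succ n ih =>
    rw [Function.iterate_succ_apply', Function.iterate_succ_apply',
      partialDeriv_comm (iterate_partialDeriv j n hf), ih]

/-- Without repetitions, `i` occurs at most once in `l`; the extra derivative arises there and
commutes outward past the remaining iterates. -/
lemma foldr_partialDeriv_add_single (hf : ContDiff ℝ ∞ f) (α : Fin d → ℕ) (i : Fin d)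
    (l : List (Fin d)) (hl : l.Nodup) :
    l.foldr (fun j g => (partialDeriv j)^[(α + Pi.single i 1 : Fin d → ℕ) j] g) f =
      if i ∈ l then partialDeriv i (l.foldr (fun j g => (partialDeriv j)^[α j] g) f)
      else l.foldr (fun j g => (partialDeriv j)^[α j] g) f := by
  induction l with
  | nil => simp
  | cons j l ih =>
    rw [List.nodup_cons] at hl
    simp only [List.foldr_cons, ih hl.2]
    by_cases hij : i = j
    · subst hij
      rw [if_neg hl.1, if_pos List.mem_cons_self, Pi.add_apply, Pi.single_eq_same,
        Function.iterate_succ_apply']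
    · have h1 : (α + Pi.single i 1 : Fin d → ℕ) j = α j := by simp [Pi.single_eq_of_ne (Ne.symm hij)]
      rw [h1]
      by_cases hil : i ∈ l
      · rw [if_pos hil, if_pos (List.mem_cons_of_mem _ hil),
          partialDeriv_iterate_comm (contDiff_foldr α l hf)]
      · rw [if_neg hil, if_neg]
        simp [hij, hil]

lemma partialDeriv_multiDeriv (hf : ContDiff ℝ ∞ f) (α : Fin d → ℕ) (i : Fin d) :
    partialDeriv i (multiDeriv α f) = multiDeriv (α + Pi.single i 1) f := by
  have := foldr_partialDeriv_add_single hf α i (List.finRange d) (List.nodup_finRange d)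
  rw [if_pos (List.mem_finRange i)] at this
  exact this.symm

end MultiDeriv

end GelfandShilov

end

noncomputable section

namespace GelfandShilov

open Filter Topology Finset MeasureTheory

/-! ### A weighted Sobolev inequality -/

section Sobolev

/-- Fundamental theorem of calculus from infinity; with values in `[0, ∞]` the non-integrable case
is trivial. -/
lemma enorm_le_lintegral_Ioi {g g' : ℝ → ℂ} (hg : ∀ t, HasDerivAt g (g' t) t)
    (hg' : Continuous g') (hlim : Tendsto g atTop (𝓝 0)) (t₀ : ℝ) :
    ‖g t₀‖ₑ ≤ ∫⁻ t in Set.Ioi t₀, ‖g' t‖ₑ := by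
  by_cases hfin : ∫⁻ t in Set.Ioi t₀, ‖g' t‖ₑ = ⊤
  · rw [hfin]
    exact le_top
  have hint : IntegrableOn g' (Set.Ioi t₀) :=
    ⟨hg'.aestronglyMeasurable, lt_top_iff_ne_top.2 hfin⟩
  have h := integral_Ioi_of_hasDerivAt_of_tendsto' (fun t _ => hg t) hint hlim
  rw [zero_sub] at h
  rw [← enorm_neg, ← h]
  exact enorm_integral_le_lintegral_enorm _

lemma enorm_le_lintegral_Iic {g g' : ℝ → ℂ} (hg : ∀ t, HasDerivAt g (g' t) t)
    (hg' : Continuous g') (hlim : Tendsto g atBot (𝓝 0)) (t₀ : ℝ) :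
    ‖g t₀‖ₑ ≤ ∫⁻ t in Set.Iic t₀, ‖g' t‖ₑ := by
  by_cases hfin : ∫⁻ t in Set.Iic t₀, ‖g' t‖ₑ = ⊤
  · rw [hfin]
    exact le_top
  have hint : IntegrableOn g' (Set.Iic t₀) :=
    ⟨hg'.aestronglyMeasurable, lt_top_iff_ne_top.2 hfin⟩
  have h := integral_Iic_of_hasDerivAt_of_tendsto' (fun t _ => hg t) hint hlim
  rw [sub_zero] at h
  rw [← h]
  exact enorm_integral_le_lintegral_enorm _

/-- Integration runs from `t₀` away from the origin, where `|t| ≥ |t₀|` and the weight is at least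
`w t₀`. -/
lemma weight_mul_enorm_le_lintegral {g g' : ℝ → ℂ} (hg : ∀ t, HasDerivAt g (g' t) t)
    (hg' : Continuous g') (htop : Tendsto g atTop (𝓝 0)) (hbot : Tendsto g atBot (𝓝 0))
    {w : ℝ → ENNReal} {t₀ : ℝ} (hw : ∀ t, |t₀| ≤ |t| → w t₀ ≤ w t) :
    w t₀ * ‖g t₀‖ₑ ≤ ∫⁻ t, w t * ‖g' t‖ₑ := by
  have key : ∀ s : Set ℝ, MeasurableSet s → (∀ t ∈ s, |t₀| ≤ |t|) →
      ‖g t₀‖ₑ ≤ ∫⁻ t in s, ‖g' t‖ₑ → w t₀ * ‖g t₀‖ₑ ≤ ∫⁻ t, w t * ‖g' t‖ₑ := by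
    intro s hs hst h
    calc w t₀ * ‖g t₀‖ₑ ≤ w t₀ * ∫⁻ t in s, ‖g' t‖ₑ := by gcongr
      _ = ∫⁻ t in s, w t₀ * ‖g' t‖ₑ := (lintegral_const_mul _ hg'.measurable.enorm).symm
      _ ≤ ∫⁻ t in s, w t * ‖g' t‖ₑ := setLIntegral_mono' hs fun t ht => by
          gcongr
          exact hw t (hst t ht)
      _ ≤ _ := setLIntegral_le_lintegral _ _
  rcases le_total 0 t₀ with h0 | h0
  · refine key (Set.Ioi t₀) measurableSet_Ioi (fun t ht => ?_)
      (enorm_le_lintegral_Ioi hg hg' htop t₀)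
    exact abs_le_abs_of_nonneg h0 (le_of_lt ht)
  · refine key (Set.Iic t₀) measurableSet_Iic (fun t ht => ?_)
      (enorm_le_lintegral_Iic hg hg' hbot t₀)
    exact abs_le_abs_of_nonpos h0 ht

variable {d : ℕ} {f : EuclideanSpace ℝ (Fin d) → ℂ}

lemma toLp_update (y : Fin d → ℝ) (i : Fin d) (t : ℝ) :
    (WithLp.toLp 2 (Function.update y i t) : EuclideanSpace ℝ (Fin d)) =
      WithLp.toLp 2 y + (t - y i) • EuclideanSpace.single i (1 : ℝ) := by
  ext j
  by_cases h : j = i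
  · subst h
    simp
  · simp [h]

lemma hasDerivAt_comp_update (hf : ContDiff ℝ ∞ f) (y : Fin d → ℝ) (i : Fin d) (t : ℝ) :
    HasDerivAt (fun t => f (WithLp.toLp 2 (Function.update y i t)))
      (partialDeriv i f (WithLp.toLp 2 (Function.update y i t))) t := by
  have h1 : HasDerivAt (fun t : ℝ => (WithLp.toLp 2 (Function.update y i t) :
      EuclideanSpace ℝ (Fin d))) (EuclideanSpace.single i (1 : ℝ)) t := by
    simp only [toLp_update]
    have := (((hasDerivAt_id t).sub_const (y i)).smul_const
      (EuclideanSpace.single i (1 : ℝ))).const_add (WithLp.toLp 2 y : EuclideanSpace ℝ (Fin d))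
    simpa using this
  exact ((hf.differentiable (by simp) _).hasFDerivAt.comp_hasDerivAt t h1)

lemma continuous_comp_update {g : EuclideanSpace ℝ (Fin d) → ℂ} (hg : Continuous g)
    (y : Fin d → ℝ) (i : Fin d) :
    Continuous fun t : ℝ => g (WithLp.toLp 2 (Function.update y i t)) := by
  refine hg.comp ?_
  simp only [toLp_update]
  fun_prop

lemma tendsto_comp_update {g : EuclideanSpace ℝ (Fin d) → ℂ}
    (hg : Tendsto g (cocompact _) (𝓝 0)) (y : Fin d → ℝ) (i : Fin d) {l : Filter ℝ}
    (hl : Tendsto (fun t : ℝ => |t|) l atTop) :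
    Tendsto (fun t : ℝ => g (WithLp.toLp 2 (Function.update y i t))) l (𝓝 0) := by
  refine hg.comp ?_
  rw [← Metric.cobounded_eq_cocompact, ← comap_norm_atTop, tendsto_comap_iff]
  refine tendsto_atTop_mono (fun t => ?_) hl
  have := PiLp.norm_apply_le (WithLp.toLp 2 (Function.update y i t)) i
  simpa using this

/-- Integrating outward along the coordinates of `s`, a weight that increases in the absolute value
of each coordinate can be kept inside the integral. -/
lemma weight_mul_enorm_le_lmarginal (hf : ContDiff ℝ ∞ f)
    (hlim : ∀ β, Tendsto (multiDeriv β f) (cocompact _) (𝓝 0))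
    {w : (Fin d → ℝ) → ENNReal} (hwm : Measurable w)
    (hw : ∀ y i t, |y i| ≤ |t| → w y ≤ w (Function.update y i t)) (s : Finset (Fin d)) :
    ∀ (β : Fin d → ℕ) (y : Fin d → ℝ), w y * ‖multiDeriv β f (WithLp.toLp 2 y)‖ₑ ≤
      lmarginal (fun _ => volume) s (fun z => w z *
        ‖multiDeriv (β + fun i => if i ∈ s then 1 else 0) f (WithLp.toLp 2 z)‖ₑ) y := by
  classical
  have hmeas : ∀ β, Measurable fun z : Fin d → ℝ =>
      w z * ‖multiDeriv β f (WithLp.toLp 2 z)‖ₑ := fun β =>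
    hwm.mul ((contDiff_multiDeriv β hf).continuous.comp
      (PiLp.continuous_toLp 2 _)).measurable.enorm
  induction s using Finset.induction_on with
  | empty =>
    intro β y
    rw [lmarginal_empty]
    simp only [Finset.notMem_empty, if_false]
    exact le_of_eq rfl
  | insert i s hi ih =>
    intro β y
    rw [lmarginal_insert _ (hmeas _) hi]
    -- Coordinate `i` raises `β` by one in that coordinate; the induction hypothesis then treats `s`
    -- at the updated point.
    have h1 := weight_mul_enorm_le_lintegral (t₀ := y i)
      (w := fun t => w (Function.update y i t))
      (fun t => hasDerivAt_comp_update (contDiff_multiDeriv β hf) y i t)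
      (continuous_comp_update (contDiff_partialDeriv i (contDiff_multiDeriv β hf)).continuous y i)
      (tendsto_comp_update (hlim β) y i tendsto_abs_atTop_atTop)
      (tendsto_comp_update (hlim β) y i tendsto_abs_atBot_atTop)
      (fun t ht => by
        rw [Function.update_eq_self]
        exact hw y i t ht)
    simp only [Function.update_eq_self] at h1
    refine h1.trans (lintegral_mono fun t => ?_)
    rw [partialDeriv_multiDeriv hf]
    refine (ih (β + Pi.single i 1) (Function.update y i t)).trans_eq ?_
    have h2 : (β + Pi.single i 1 + fun j => if j ∈ s then 1 else 0) =
        β + fun j => if j ∈ insert i s then 1 else 0 := by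
      funext j
      by_cases hj : j = i
      · subst hj
        simp [hi]
      · simp [hj]
    rw [h2]

/-- The price is one derivative in each coordinate, `d` in total; `WeightSequence.IsGain.deriv`
absorbs it later. -/
lemma weight_mul_enorm_le_lintegral_multiDeriv (hf : ContDiff ℝ ∞ f)
    (hlim : ∀ β, Tendsto (multiDeriv β f) (cocompact _) (𝓝 0))
    {w : (Fin d → ℝ) → ENNReal} (hwm : Measurable w)
    (hw : ∀ y i t, |y i| ≤ |t| → w y ≤ w (Function.update y i t)) (β : Fin d → ℕ)
    (y : Fin d → ℝ) : w y * ‖multiDeriv β f (WithLp.toLp 2 y)‖ₑ ≤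
      ∫⁻ z, w z * ‖multiDeriv (β + 1) f (WithLp.toLp 2 z)‖ₑ := by
  have h := weight_mul_enorm_le_lmarginal hf hlim hwm hw Finset.univ β y
  rw [lmarginal_univ] at h
  simp only [Finset.mem_univ, if_true] at h
  exact h

end Sobolev

end GelfandShilov

end

noncomputable section

namespace GelfandShilov

open Filter Topology Finset MeasureTheory

/-! ### Domination between the steps -/

section StepDomination

variable {M A : WeightSequence} {d : ℕ}

/-- The product `κ h` as an index. -/
def PosReal.scale (κ : ℝ) (hκ : 0 < κ) (h : PosReal) : PosReal := ⟨κ * h, mul_pos hκ h.2⟩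

/-- The weight `h^{|α|} e^{A(hρ)} / M_{|α|}`. -/
def stepCoef (M A : WeightSequence) (h : PosReal) (n : ℕ) (ρ : ℝ) : ℝ :=
  (h : ℝ) ^ n * Real.exp (A.assoc (h * ρ)) / M n

lemma stepCoef_pos (h : PosReal) (n : ℕ) (ρ : ℝ) : 0 < stepCoef M A h n ρ := by
  have h1 := M.pos n
  have h2 := h.2
  unfold stepCoef
  positivity

lemma stepTerm_eq (h : PosReal) (φ : EuclideanSpace ℝ (Fin d) → ℂ)
    (k : (Fin d → ℕ) × EuclideanSpace ℝ (Fin d)) :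
    stepTerm M A h φ k = stepCoef M A h (∑ i, k.1 i) ‖k.2‖ * ‖multiDeriv k.1 φ k.2‖ := by
  unfold stepTerm stepCoef
  ring

lemma stepCoef_mono_radius (hA : A.DominatesFactorial) (h : PosReal) (n : ℕ) {ρ σ : ℝ}
    (hρ : 0 ≤ ρ) (hσ : ρ ≤ σ) : stepCoef M A h n ρ ≤ stepCoef M A h n σ := by
  have h1 := M.pos n
  have h2 := h.2
  have h3 : A.assoc (h * ρ) ≤ A.assoc (h * σ) :=
    WeightSequence.assoc_mono hA (by positivity) (by gcongr)
  unfold stepCoef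
  gcongr

lemma stepCoef_mono (hA : A.DominatesFactorial) {h h' : PosReal} (hh : h ≤ h') (n : ℕ) {ρ : ℝ}
    (hρ : 0 ≤ ρ) : stepCoef M A h n ρ ≤ stepCoef M A h' n ρ := by
  have h1 := M.pos n
  have h2 := h.2
  have h4 : (h : ℝ) ≤ h' := hh
  have h5 := h'.2
  have h3 : A.assoc (h * ρ) ≤ A.assoc (h' * ρ) :=
    WeightSequence.assoc_mono hA (by positivity) (by gcongr)
  unfold stepCoef
  gcongr

lemma stepTerm_mono (hA : A.DominatesFactorial) {h h' : PosReal} (hh : h ≤ h')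
    (φ : EuclideanSpace ℝ (Fin d) → ℂ) (k : (Fin d → ℕ) × EuclideanSpace ℝ (Fin d)) :
    stepTerm M A h φ k ≤ stepTerm M A h' φ k := by
  rw [stepTerm_eq, stepTerm_eq]
  exact mul_le_mul_of_nonneg_right (stepCoef_mono hA hh _ (norm_nonneg _)) (norm_nonneg _)

lemma stepSubmodule_anti (hA : A.DominatesFactorial) {h h' : PosReal} (hh : h ≤ h') :
    stepSubmodule M A d h' ≤ stepSubmodule M A d h := by
  rintro φ ⟨hφ, C, hC⟩
  refine ⟨hφ, C, ?_⟩
  rintro _ ⟨k, rfl⟩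
  exact (stepTerm_mono hA hh φ k).trans (hC ⟨k, rfl⟩)

lemma Step.norm_le {h : PosReal} (φ : Step M A d h) {C : ℝ}
    (hC : ∀ k, stepTerm M A h φ.fn k ≤ C) : ‖φ‖ ≤ C :=
  ciSup_le hC

lemma Step.ext {h : PosReal} {φ ψ : Step M A d h} (hφ : φ.fn = ψ.fn) : φ = ψ := Subtype.ext hφ

/-- An element of the step from its underlying function. -/
def Step.ofMem {h : PosReal} (f : EuclideanSpace ℝ (Fin d) → ℂ) (hf : f ∈ stepSubmodule M A d h) :
    Step M A d h := ⟨f, hf⟩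

lemma Step.fn_ofMem {h : PosReal} (f : EuclideanSpace ℝ (Fin d) → ℂ)
    (hf : f ∈ stepSubmodule M A d h) : (Step.ofMem f hf).fn = f := rfl

lemma Step.inclusion_apply {h h' : PosReal}
    (hle : stepSubmodule M A d h' ≤ stepSubmodule M A d h) (φ : Step M A d h') :
    Step.inclusion hle φ = Step.ofMem φ.fn (hle φ.2) := rfl

lemma Step.fn_inclusion {h h' : PosReal} (hle : stepSubmodule M A d h' ≤ stepSubmodule M A d h)
    (φ : Step M A d h') : (Step.inclusion hle φ).fn = φ.fn := by
  rw [Step.inclusion_apply, Step.fn_ofMem]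

lemma Step.norm_inclusion_le (hA : A.DominatesFactorial) {h h' : PosReal} (hh : h ≤ h')
    (hle : stepSubmodule M A d h' ≤ stepSubmodule M A d h) (φ : Step M A d h') :
    ‖Step.inclusion hle φ‖ ≤ ‖φ‖ :=
  Step.norm_le _ fun k => by
    rw [Step.fn_inclusion]
    exact (stepTerm_mono hA hh φ.fn k).trans (φ.stepTerm_le_norm k)

/-! ### Gains in the weights from dilating the index by `κ`, and the weighted L² norm. -/

variable {κ : ℝ}

/-- Here `(κ h) ^ n` supplies `κ⁻¹ ^ n`, for summation over multi-indices, and the growth of `e^A`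
supplies the decay in `ρ`, for integration. -/
lemma exists_stepCoef_le_decay (hκ : WeightSequence.IsGain M A κ) (h : PosReal) (m : ℕ) :
    ∃ C : ℝ, 0 < C ∧ ∀ n ρ, 0 ≤ ρ → stepCoef M A h n ρ ≤
      C * (κ⁻¹ ^ n * ((1 + ρ) ^ m)⁻¹) * stepCoef M A (PosReal.scale κ hκ.pos h) n ρ := by
  obtain ⟨C, hC, hd⟩ := hκ.decay h m
  refine ⟨C, hC, fun n ρ hρ => ?_⟩
  have h1 := M.pos n
  have h2 := h.2
  have h3 := hκ.pos
  have h4 : Real.exp (A.assoc (h * ρ)) ≤ C * Real.exp (A.assoc (κ * h * ρ)) / (1 + ρ) ^ m := by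
    rw [le_div_iff₀ (by positivity)]
    exact hd ρ hρ
  unfold stepCoef PosReal.scale
  calc (h : ℝ) ^ n * Real.exp (A.assoc (h * ρ)) / M n
      ≤ (h : ℝ) ^ n * (C * Real.exp (A.assoc (κ * h * ρ)) / (1 + ρ) ^ m) / M n := by gcongr
    _ = _ := by
      simp only [mul_pow, inv_pow]
      field_simp

/-- Here the factor `κ ^ n` is spent on `M (n + l) ≤ C' * κ ^ n * M n` instead; the `l` surplus
powers of `κ h` go into the constant. -/
lemma exists_stepCoef_le_deriv (hκ : WeightSequence.IsGain M A κ) (h : PosReal) (m l : ℕ) :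
    ∃ C : ℝ, 0 < C ∧ ∀ n ρ, 0 ≤ ρ → stepCoef M A h n ρ ≤
      C * ((1 + ρ) ^ m)⁻¹ * stepCoef M A (PosReal.scale κ hκ.pos h) (n + l) ρ := by
  obtain ⟨C, hC, hd⟩ := hκ.decay h m
  obtain ⟨C', hC', hM⟩ := hκ.deriv l
  have h2 := h.2
  have h3 := hκ.pos
  refine ⟨C * (C' * (κ * h)⁻¹ ^ l), by positivity, fun n ρ hρ => ?_⟩
  have h1 := M.pos n
  have h1' := M.pos (n + l)
  have h4 : Real.exp (A.assoc (h * ρ)) ≤ C * Real.exp (A.assoc (κ * h * ρ)) / (1 + ρ) ^ m := by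
    rw [le_div_iff₀ (by positivity)]
    exact hd ρ hρ
  have h5 : (M n)⁻¹ ≤ C' * κ ^ n / M (n + l) := by
    rw [inv_le_iff_one_le_mul₀' h1, mul_div_assoc', one_le_div h1', mul_comm]
    exact hM n
  unfold stepCoef PosReal.scale
  calc (h : ℝ) ^ n * Real.exp (A.assoc (h * ρ)) / M n
      = (h : ℝ) ^ n * Real.exp (A.assoc (h * ρ)) * (M n)⁻¹ := div_eq_mul_inv _ _
    _ ≤ (h : ℝ) ^ n * (C * Real.exp (A.assoc (κ * h * ρ)) / (1 + ρ) ^ m) *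
        (C' * κ ^ n / M (n + l)) := by gcongr
    _ = _ := by
      simp only [mul_pow, pow_add, inv_pow]
      field_simp

/-- The weighted derivative `φ ↦ h^{|α|} e^{A(h|y|)} D^α φ(y) / M_{|α|}` on a step. -/
def stepFunctional (h h' : PosReal) (k : (Fin d → ℕ) × (Fin d → ℝ)) : Step M A d h' →ₗ[ℂ] ℂ where
  toFun φ := (stepCoef M A h (∑ i, k.1 i) ‖(WithLp.toLp 2 k.2 : EuclideanSpace ℝ (Fin d))‖ : ℂ) *
    multiDeriv k.1 φ.fn (WithLp.toLp 2 k.2)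
  map_add' φ ψ := by
    rw [← mul_add]
    congr 1
    exact congrFun (multiDeriv_add k.1 φ.contDiff ψ.contDiff) _
  map_smul' c φ := by
    have h1 : multiDeriv k.1 (c • φ).fn = c • multiDeriv k.1 φ.fn :=
      multiDeriv_smul k.1 c φ.contDiff
    rw [h1, Pi.smul_apply, RingHom.id_apply, smul_eq_mul, smul_eq_mul]
    ring

lemma norm_stepFunctional (h h' : PosReal) (k : (Fin d → ℕ) × (Fin d → ℝ)) (φ : Step M A d h') :
    ‖stepFunctional h h' k φ‖ = stepTerm M A h φ.fn (k.1, WithLp.toLp 2 k.2) := by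
  rw [stepTerm_eq]
  change ‖(_ : ℂ) * _‖ = _
  rw [norm_mul, Complex.norm_real, Real.norm_of_nonneg (stepCoef_pos _ _ _).le]

lemma measurable_stepCoef (h : PosReal) (n : ℕ) :
    Measurable fun y : Fin d → ℝ =>
      stepCoef M A h n ‖(WithLp.toLp 2 y : EuclideanSpace ℝ (Fin d))‖ := by
  have h1 : Measurable fun y : Fin d → ℝ => ‖(WithLp.toLp 2 y : EuclideanSpace ℝ (Fin d))‖ :=
    (PiLp.continuous_toLp 2 _).measurable.norm
  unfold stepCoef
  exact ((Real.measurable_exp.comp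
    (WeightSequence.measurable_assoc.comp (h1.const_mul _))).const_mul _).div_const _

lemma measurable_stepFunctional (h h' : PosReal) (φ : Step M A d h') :
    Measurable fun k : (Fin d → ℕ) × (Fin d → ℝ) => stepFunctional h h' k φ := by
  refine measurable_from_prod_countable_right fun α => ?_
  change Measurable fun y : Fin d → ℝ =>
    (stepCoef M A h (∑ i, α i) ‖(WithLp.toLp 2 y : EuclideanSpace ℝ (Fin d))‖ : ℂ) *
      multiDeriv α φ.fn (WithLp.toLp 2 y)
  refine (Complex.measurable_ofReal.comp (measurable_stepCoef h _)).mul ?_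
  exact ((contDiff_multiDeriv α φ.contDiff).continuous.comp
    (PiLp.continuous_toLp 2 _)).measurable

/-- A square integrable majorant of the norms of the functionals. -/
def stepMajorant (d : ℕ) (κ : ℝ) (k : (Fin d → ℕ) × (Fin d → ℝ)) : ℝ :=
  κ⁻¹ ^ (∑ i, k.1 i) * ((1 + ‖k.2‖) ^ (d + 1))⁻¹

/-- A finite set of multi-indices lies in a cube, where the sum factors into `d` partial geometric
sums. -/
lemma summable_pow_sum (d : ℕ) {r : ℝ} (hr0 : 0 ≤ r) (hr : r < 1) :
    Summable fun α : Fin d → ℕ => r ^ (∑ i, α i) := by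
  classical
  refine summable_of_sum_le (c := ((1 - r)⁻¹) ^ d) (fun α => pow_nonneg hr0 _) fun s => ?_
  set n := s.sup (fun α => ∑ i, α i) + 1
  have hsub : s ⊆ Fintype.piFinset fun _ : Fin d => Finset.range n := fun α hα => by
    rw [Fintype.mem_piFinset]
    intro i
    rw [Finset.mem_range]
    have h1 : α i ≤ ∑ j, α j := Finset.single_le_sum (fun _ _ => Nat.zero_le _) (Finset.mem_univ i)
    have h2 : ∑ j, α j ≤ s.sup (fun α => ∑ i, α i) :=
      Finset.le_sup (f := fun α : Fin d → ℕ => ∑ i, α i) hα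
    omega
  refine (Finset.sum_le_sum_of_subset_of_nonneg hsub fun _ _ _ => pow_nonneg hr0 _).trans ?_
  simp only [← Finset.prod_pow_eq_pow_sum]
  rw [Finset.sum_prod_piFinset (Finset.range n) fun _ j => r ^ j]
  rw [Finset.prod_const, Finset.card_univ, Fintype.card_fin]
  refine pow_le_pow_left₀ (Finset.sum_nonneg fun _ _ => pow_nonneg hr0 _) ?_ d
  rw [← tsum_geometric_of_lt_one hr0 hr]
  exact (summable_geometric_of_lt_one hr0 hr).sum_le_tsum _ fun _ _ => pow_nonneg hr0 _

lemma integrable_inv_one_add_norm_pow_sq (d : ℕ) :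
    Integrable fun y : Fin d → ℝ => (((1 + ‖y‖) ^ (d + 1))⁻¹) ^ 2 := by
  have h := integrable_one_add_norm (E := Fin d → ℝ) (μ := volume) (r := ((2 * (d + 1) : ℕ) : ℝ))
    (by
      rw [Module.finrank_fin_fun]
      exact_mod_cast (by omega : d < 2 * (d + 1)))
  refine h.congr (Eventually.of_forall fun y => ?_)
  have : (0 : ℝ) ≤ 1 + ‖y‖ := by positivity
  simp only
  rw [Real.rpow_neg this, Real.rpow_natCast, inv_pow, ← pow_mul, mul_comm 2]

lemma integrable_stepMajorant_sq (d : ℕ) (hκ : 2 ≤ κ) :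
    Integrable (fun k => stepMajorant d κ k ^ 2)
      ((Measure.count : Measure (Fin d → ℕ)).prod volume) := by
  have h1 : Integrable (fun α : Fin d → ℕ => (κ⁻¹ ^ 2) ^ (∑ i, α i)) Measure.count := by
    refine integrable_count_iff.2 (summable_pow_sum d (by positivity) ?_).norm
    have : κ⁻¹ < 1 := inv_lt_one_of_one_lt₀ (by linarith)
    exact pow_lt_one₀ (inv_nonneg.2 (by linarith)) this two_ne_zero
  refine (h1.mul_prod (integrable_inv_one_add_norm_pow_sq d)).congr
    (Eventually.of_forall fun k => ?_)
  simp only [stepMajorant, mul_pow]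
  rw [← pow_mul, ← pow_mul, mul_comm 2]

lemma exists_norm_stepFunctional_le (hκ : WeightSequence.IsGain M A κ) (h : PosReal) :
    ∃ C : ℝ, 0 < C ∧ ∀ k (φ : Step M A d (PosReal.scale κ hκ.pos h)),
      ‖stepFunctional h _ k φ‖ ≤ C * stepMajorant d κ k * ‖φ‖ := by
  obtain ⟨C, hC, hle⟩ := exists_stepCoef_le_decay hκ h (d + 1)
  refine ⟨C, hC, fun k φ => ?_⟩
  set x : EuclideanSpace ℝ (Fin d) := WithLp.toLp 2 k.2
  have hκ0 := hκ.pos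
  -- The measure lives on `Fin d → ℝ` with the maximum norm, which is at most the Euclidean norm in
  -- the weight.
  have h1 : ‖k.2‖ ≤ ‖x‖ := (pi_norm_le_iff_of_nonneg (norm_nonneg _)).2 fun i =>
    PiLp.norm_apply_le x i
  have h2 := φ.stepTerm_le_norm (k.1, x)
  rw [norm_stepFunctional, stepTerm_eq]
  rw [stepTerm_eq] at h2
  have hpos := stepCoef_pos (M := M) (A := A) (PosReal.scale κ hκ.pos h) (∑ i, k.1 i) ‖x‖
  calc stepCoef M A h (∑ i, k.1 i) ‖x‖ * ‖multiDeriv k.1 φ.fn x‖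
      ≤ C * (κ⁻¹ ^ (∑ i, k.1 i) * ((1 + ‖x‖) ^ (d + 1))⁻¹) *
        stepCoef M A (PosReal.scale κ hκ.pos h) (∑ i, k.1 i) ‖x‖ * ‖multiDeriv k.1 φ.fn x‖ :=
        mul_le_mul_of_nonneg_right (hle _ _ (norm_nonneg _)) (norm_nonneg _)
    _ = C * (κ⁻¹ ^ (∑ i, k.1 i) * ((1 + ‖x‖) ^ (d + 1))⁻¹) *
        (stepCoef M A (PosReal.scale κ hκ.pos h) (∑ i, k.1 i) ‖x‖ * ‖multiDeriv k.1 φ.fn x‖) := by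
        ring
    _ ≤ C * (κ⁻¹ ^ (∑ i, k.1 i) * ((1 + ‖k.2‖) ^ (d + 1))⁻¹) * ‖φ‖ := by
        gcongr

/-- The term `p = 1` with `A 1 = 1` gives `e^{A(h‖x‖)} ≥ h‖x‖`, so `‖x‖` times the derivative is
bounded. This is the vanishing at infinity required by the Sobolev inequality. -/
lemma Step.tendsto_multiDeriv (hA : A.DominatesFactorial) {h : PosReal} (φ : Step M A d h)
    (β : Fin d → ℕ) : Tendsto (multiDeriv β φ.fn) (cocompact _) (𝓝 0) := by
  have hh := h.2
  have hM := M.pos (∑ i, β i)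
  set c : ℝ := (h : ℝ) ^ (∑ i, β i) * h / M (∑ i, β i)
  have hc : 0 < c := by positivity
  have hle : ∀ x, c * ‖x‖ * ‖multiDeriv β φ.fn x‖ ≤ ‖φ‖ := fun x => by
    refine le_trans ?_ (φ.stepTerm_le_norm (β, x))
    rw [stepTerm_eq]
    refine mul_le_mul_of_nonneg_right ?_ (norm_nonneg _)
    have h1 := WeightSequence.pow_div_le_exp_assoc hA (show 0 ≤ (h : ℝ) * ‖x‖ by positivity) 1
    rw [A.map_one, div_one, pow_one] at h1
    unfold stepCoef
    calc c * ‖x‖ = (h : ℝ) ^ (∑ i, β i) * (h * ‖x‖) / M (∑ i, β i) := by ring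
      _ ≤ _ := by gcongr
  have hnorm : Tendsto (fun x : EuclideanSpace ℝ (Fin d) => ‖x‖) (cocompact _) atTop :=
    tendsto_norm_cocompact_atTop
  rw [tendsto_zero_iff_norm_tendsto_zero]
  have hlim : Tendsto (fun x : EuclideanSpace ℝ (Fin d) => ‖φ‖ / c * ‖x‖⁻¹) (cocompact _) (𝓝 0) := by
    simpa using (tendsto_inv_atTop_zero.comp hnorm).const_mul (‖φ‖ / c)
  refine squeeze_zero' (Eventually.of_forall fun x => norm_nonneg _) ?_ hlim
  filter_upwards [hnorm.eventually_gt_atTop 0] with x hx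
  rw [div_mul_eq_mul_div, le_div_iff₀ hc, ← div_eq_mul_inv, le_div_iff₀ hx]
  linarith [hle x]

lemma norm_toLp_le_update (y : Fin d → ℝ) (i : Fin d) (t : ℝ) (ht : |y i| ≤ |t|) :
    ‖(WithLp.toLp 2 y : EuclideanSpace ℝ (Fin d))‖ ≤
      ‖(WithLp.toLp 2 (Function.update y i t) : EuclideanSpace ℝ (Fin d))‖ := by
  rw [EuclideanSpace.norm_eq, EuclideanSpace.norm_eq]
  refine Real.sqrt_le_sqrt (Finset.sum_le_sum fun j _ => ?_)
  by_cases hj : j = i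
  · subst hj
    simpa using sq_le_sq.2 ht
  · simp [hj]

lemma lintegral_stepFunctional_le (h h' : PosReal) (φ : Step M A d h') (α : Fin d → ℕ) :
    ∫⁻ y : Fin d → ℝ, ‖stepFunctional h h' (α, y) φ‖ₑ ^ 2 ≤
      ∫⁻ k, ‖stepFunctional h h' k φ‖ₑ ^ 2 ∂((Measure.count : Measure (Fin d → ℕ)).prod volume) := by
  rw [lintegral_prod _ ((measurable_stepFunctional h h' φ).enorm.pow_const 2).aemeasurable,
    lintegral_count]
  exact ENNReal.le_tsum (f := fun α => ∫⁻ y : Fin d → ℝ, ‖stepFunctional h h' (α, y) φ‖ₑ ^ 2) α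

/-- The `σ_h` norm is bounded by the weighted `L²` norm of index `κ h`. -/
lemma exists_stepTerm_le_lintegral (hκ : WeightSequence.IsGain M A κ)
    (hA : A.DominatesFactorial) (h h' : PosReal) :
    ∃ C : NNReal, ∀ (φ : Step M A d h') k, ENNReal.ofReal (stepTerm M A h φ.fn k) ≤
      C * (∫⁻ k, ‖stepFunctional (PosReal.scale κ hκ.pos h) h' k φ‖ₑ ^ 2
        ∂((Measure.count : Measure (Fin d → ℕ)).prod volume)) ^ (1 / 2 : ℝ) := by
  -- The order rises by `l = d`; the decay `d + 1` makes the factor `b` below square integrable.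
  obtain ⟨C, hC, hle⟩ := exists_stepCoef_le_deriv hκ h (d + 1) d
  set b : (Fin d → ℝ) → ENNReal := fun y => ENNReal.ofReal (((1 + ‖y‖) ^ (d + 1))⁻¹)
  have hb : ∫⁻ y, b y ^ (2 : ℝ) ≠ ⊤ := by
    have h1 := (integrable_inv_one_add_norm_pow_sq d).lintegral_lt_top.ne
    convert h1 using 3 with y
    rw [ENNReal.rpow_ofNat, ENNReal.ofReal_pow (by positivity)]
  have hbm : Measurable b := by
    refine ENNReal.measurable_ofReal.comp (Measurable.inv ?_)
    fun_prop
  refine ⟨C.toNNReal * ((∫⁻ y, b y ^ (2 : ℝ)) ^ (1 / 2 : ℝ)).toNNReal, fun φ k => ?_⟩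
  obtain ⟨α, x⟩ := k
  obtain ⟨y, rfl⟩ : ∃ y, x = WithLp.toLp 2 y := ⟨x.ofLp, rfl⟩
  set n := ∑ i, α i
  set w : (Fin d → ℝ) → ENNReal := fun y =>
    ENNReal.ofReal (stepCoef M A h n ‖(WithLp.toLp 2 y : EuclideanSpace ℝ (Fin d))‖)
  have h1 := weight_mul_enorm_le_lintegral_multiDeriv φ.contDiff (φ.tendsto_multiDeriv hA)
    (w := w) (ENNReal.measurable_ofReal.comp (measurable_stepCoef h n))
    (fun y i t ht => ENNReal.ofReal_le_ofReal
      (stepCoef_mono_radius hA h n (norm_nonneg _) (norm_toLp_le_update y i t ht))) α y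
  have hsum : ∑ i, (α + 1 : Fin d → ℕ) i = n + d := by
    simp [Finset.sum_add_distrib, n]
  have h2 : ∀ z : Fin d → ℝ, w z * ‖multiDeriv (α + 1) φ.fn (WithLp.toLp 2 z)‖ₑ ≤
      ENNReal.ofReal C * (b z *
        ‖stepFunctional (PosReal.scale κ hκ.pos h) h' (α + 1, z) φ‖ₑ) := fun z => by
    set x : EuclideanSpace ℝ (Fin d) := WithLp.toLp 2 z
    have hx : ‖z‖ ≤ ‖x‖ := (pi_norm_le_iff_of_nonneg (norm_nonneg _)).2 fun i =>
      PiLp.norm_apply_le x i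
    rw [← ofReal_norm, ← ofReal_norm, norm_stepFunctional, stepTerm_eq]
    simp only [w, b]
    rw [← ENNReal.ofReal_mul (stepCoef_pos _ _ _).le, ← ENNReal.ofReal_mul (by positivity),
      ← ENNReal.ofReal_mul hC.le]
    refine ENNReal.ofReal_le_ofReal ?_
    simp only [hsum]
    have hpos := stepCoef_pos (M := M) (A := A) (PosReal.scale κ hκ.pos h) (n + d) ‖x‖
    calc stepCoef M A h n ‖x‖ * ‖multiDeriv (α + 1) φ.fn x‖
        ≤ C * ((1 + ‖x‖) ^ (d + 1))⁻¹ * stepCoef M A (PosReal.scale κ hκ.pos h) (n + d) ‖x‖ *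
          ‖multiDeriv (α + 1) φ.fn x‖ :=
          mul_le_mul_of_nonneg_right (hle n ‖x‖ (norm_nonneg _)) (norm_nonneg _)
      _ ≤ C * ((1 + ‖z‖) ^ (d + 1))⁻¹ * stepCoef M A (PosReal.scale κ hκ.pos h) (n + d) ‖x‖ *
          ‖multiDeriv (α + 1) φ.fn x‖ := by gcongr
      _ = _ := by ring
  have hfm : Measurable fun z : Fin d → ℝ =>
      ‖stepFunctional (PosReal.scale κ hκ.pos h) h' (α + 1, z) φ‖ₑ :=
    ((measurable_stepFunctional _ h' φ).comp measurable_prodMk_left).enorm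
  -- Cauchy–Schwarz passes from the L¹ bound of the Sobolev inequality to L²; only the slice `α + 1`
  -- of the full square sum is needed.
  have h3 := ENNReal.lintegral_mul_le_Lp_mul_Lq volume Real.HolderConjugate.two_two
    hbm.aemeasurable hfm.aemeasurable
  have h4 : ENNReal.ofReal (stepTerm M A h φ.fn (α, WithLp.toLp 2 y)) =
      w y * ‖multiDeriv α φ.fn (WithLp.toLp 2 y)‖ₑ := by
    rw [stepTerm_eq, ENNReal.ofReal_mul (stepCoef_pos _ _ _).le, ofReal_norm]
  have hbfin : (∫⁻ y, b y ^ (2 : ℝ)) ^ (1 / 2 : ℝ) ≠ ⊤ :=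
    ENNReal.rpow_ne_top_of_nonneg (by norm_num) hb
  rw [h4, ENNReal.coe_mul, ENNReal.coe_toNNReal hbfin, mul_assoc]
  refine h1.trans ((lintegral_mono h2).trans ?_)
  rw [lintegral_const_mul' _ _ ENNReal.ofReal_ne_top]
  refine mul_le_mul_right (h3.trans (mul_le_mul_right (ENNReal.rpow_le_rpow ?_ (by norm_num)) _)) _
  simp only [ENNReal.rpow_ofNat]
  exact lintegral_stepFunctional_le _ h' φ (α + 1)

/-- The norm of the step `h` is dominated, through a Hilbertian seminorm, by that of `κ² h`. -/
theorem Step.hilbertLE (hκ : WeightSequence.IsGain M A κ) (hA : A.DominatesFactorial) (h : PosReal)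
    (hle : stepSubmodule M A d (PosReal.scale κ hκ.pos (PosReal.scale κ hκ.pos h)) ≤
      stepSubmodule M A d h) :
    HilbertLE ((normSeminorm ℂ (Step M A d h)).comp (Step.inclusion hle))
      (normSeminorm ℂ (Step M A d (PosReal.scale κ hκ.pos (PosReal.scale κ hκ.pos h)))) := by
  let h₁ := PosReal.scale κ hκ.pos h
  let h₂ := PosReal.scale κ hκ.pos h₁
  set μ : Measure ((Fin d → ℕ) × (Fin d → ℝ)) := Measure.count.prod volume
  -- The passage from `h₁` to `h₂` gains the square integrable majorant, hence two-summability.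
  obtain ⟨C, hC, hbound⟩ := exists_norm_stepFunctional_le (d := d) hκ h₁
  have hk : Integrable (fun k => (C * stepMajorant d κ k) ^ 2) μ := by
    simp only [mul_pow]
    exact (integrable_stepMajorant_sq d hκ.two_le).const_mul _
  have hmem : ∀ φ : Step M A d h₂, MemLp (fun k => stepFunctional h₁ h₂ k φ) 2 μ := fun φ => by
    rw [memLp_two_iff_integrable_sq_norm (measurable_stepFunctional h₁ h₂ φ).aestronglyMeasurable]
    refine (hk.mul_const (‖φ‖ ^ 2)).mono'
      ((measurable_stepFunctional h₁ h₂ φ).norm.pow_const 2).aestronglyMeasurable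
      (Eventually.of_forall fun k => ?_)
    rw [Real.norm_of_nonneg (sq_nonneg _), ← mul_pow]
    exact pow_le_pow_left₀ (norm_nonneg _) (hbound k φ) 2
  obtain ⟨N, hN, hNint⟩ := exists_isHilbertian_integral μ (stepFunctional h₁ h₂) hmem
  have hts : TwoSumming N (normSeminorm ℂ (Step M A d h₂)) :=
    twoSumming_integral _ hmem hNint hk hbound
  -- The passage from `h` to `h₁` is the Sobolev estimate, which bounds the supremum norm by `N`.
  obtain ⟨K, hK⟩ := exists_stepTerm_le_lintegral (d := d) hκ hA h h₂
  have hle' : HilbertLE N (normSeminorm ℂ (Step M A d h₂)) := ⟨N, hN, le_rfl, hts⟩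
  refine hle'.mono (C := K) (C' := 1) K.coe_nonneg (fun φ => ?_) one_pos fun φ => (one_mul _).ge
  refine Step.norm_le _ fun k => ?_
  rw [Step.fn_inclusion]
  have h1 := hK φ k
  have h2 : ∫⁻ k, ‖stepFunctional h₁ h₂ k φ‖ₑ ^ 2 ∂μ = ENNReal.ofReal (N φ ^ 2) := by
    rw [hNint, ofReal_integral_eq_lintegral_ofReal
      ((memLp_two_iff_integrable_sq_norm (hmem φ).1).1 (hmem φ))
      (Eventually.of_forall fun k => sq_nonneg _)]
    refine lintegral_congr fun k => ?_
    rw [ENNReal.ofReal_pow (norm_nonneg _), ofReal_norm]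
  rw [h2, ENNReal.ofReal_rpow_of_nonneg (sq_nonneg _) (by norm_num), ← Real.sqrt_eq_rpow,
    Real.sqrt_sq (apply_nonneg _ _), ← ENNReal.ofReal_coe_nnreal, ← ENNReal.ofReal_mul K.coe_nonneg] at h1
  exact (ENNReal.ofReal_le_ofReal_iff (mul_nonneg K.coe_nonneg (apply_nonneg _ _))).1 h1

end StepDomination

end GelfandShilov

end

noncomputable section

namespace GelfandShilov

open Filter Topology Finset

/-! ### Polars of bounded sets -/

section Polar

variable {E F : Type*} [AddCommGroup E] [Module ℂ E] [AddCommGroup F] [Module ℂ F]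

/-- All the seminorms `pₙ` are bounded on `U`. -/
def SeminormBounded (p : ℕ → Seminorm ℂ F) (U : Set F) : Prop :=
  ∀ n, ∃ C : ℝ, ∀ f ∈ U, p n f ≤ C

lemma SeminormBounded.pointwiseBounded {p : ℕ → Seminorm ℂ F} {U : Set F}
    (hU : SeminormBounded p U) {B : E →ₗ[ℂ] F →ₗ[ℂ] ℂ}
    (hB : ∀ x, ∃ (n : ℕ) (C : ℝ), 0 ≤ C ∧ ∀ f, ‖B x f‖ ≤ C * p n f) : PointwiseBounded B U :=
  fun x => by
    obtain ⟨n, C, hC0, hC⟩ := hB x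
    obtain ⟨K, hK⟩ := hU n
    exact ⟨C * K, fun f hf => (hC f).trans (mul_le_mul_of_nonneg_left (hK f hf) hC0)⟩

/-- If a sequence of seminorms is increasing for the domination through Hilbertian seminorms, then
the polar seminorms of bounded sets dominate each other in the same way. -/
theorem SeminormBounded.exists_hilbertLE {p : ℕ → Seminorm ℂ F}
    (hp : ∀ n, HilbertLE (p n) (p (n + 1))) {B : E →ₗ[ℂ] F →ₗ[ℂ] ℂ}
    (hB : ∀ x, ∃ (n : ℕ) (C : ℝ), 0 ≤ C ∧ ∀ f, ‖B x f‖ ≤ C * p n f) {U : Set F}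
    (hU : SeminormBounded p U) :
    ∃ V W : Set F, U ⊆ V ∧ SeminormBounded p V ∧ SeminormBounded p W ∧
      HilbertLE (polarSeminorm B V) (polarSeminorm B W) := by
  choose N hN hpN hNs using hp
  have hNs' : ∀ n, TwoSumming (N n) (N (n + 1)) := fun n =>
    (hNs n).mono_right one_pos fun x => by simpa using hpN (n + 1) x
  have hB' : ∀ x, ∃ (n : ℕ) (C : ℝ), 0 ≤ C ∧ ∀ f, ‖B x f‖ ≤ C * N n f := fun x => by
    obtain ⟨n, C, hC0, hC⟩ := hB x
    exact ⟨n, C, hC0, fun f => (hC f).trans (mul_le_mul_of_nonneg_left (hpN n f) hC0)⟩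
  have hball : ∀ w : ℕ → ℝ, (∀ n, 0 < w n) → SeminormBounded p (weightedBall N w) :=
    fun w hw n => ⟨√(w n)⁻¹, fun f hf => (hpN n f).trans (le_of_mem_weightedBall hw hf n)⟩
  choose C hC0 hC using fun n => (hNs n).exists_le
  choose K hK using hU
  -- A bound for `N n ^ 2` on `U`, made positive by the `1`; the weights `w` then place `U` in the
  -- ball by a geometric series.
  set D : ℕ → ℝ := fun n => (C n * K (n + 1)) ^ 2 + 1
  have hD : ∀ n, 0 < D n := fun n => by positivity
  set w : ℕ → ℝ := fun n => (1 / 2) ^ (n + 1) / D n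
  have hw : ∀ n, 0 < w n := fun n => div_pos (by positivity) (hD n)
  obtain ⟨w', hw', h⟩ := exists_hilbertLE_polarSeminorm hN hNs' hB' hw
  refine ⟨weightedBall N w, weightedBall N w', fun f hf s => ?_, hball w hw, hball w' hw', h⟩
  have h1 : HasSum (fun n : ℕ => (1 / 2 : ℝ) ^ (n + 1)) 1 := by
    simpa [pow_succ] using hasSum_geometric_two.mul_right (1 / 2 : ℝ)
  refine le_trans (Finset.sum_le_sum fun n _ => ?_) (sum_le_hasSum s (fun n _ => by positivity) h1)
  have h2 : N n f ≤ C n * K (n + 1) :=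
    (hC n f).trans (mul_le_mul_of_nonneg_left (hK (n + 1) f hf) (hC0 n).le)
  have h3 : N n f ^ 2 ≤ D n :=
    (pow_le_pow_left₀ (apply_nonneg _ _) h2 2).trans (le_add_of_nonneg_right zero_le_one)
  calc w n * N n f ^ 2 ≤ w n * D n := mul_le_mul_of_nonneg_left h3 (hw n).le
    _ = _ := div_mul_cancel₀ _ (hD n).ne'

end Polar

/-! ### Transposes of nuclear maps -/

section Transpose

/-- The transpose of a nuclear map gives domination between dual norms. -/
lemma IsNuclearMap.hilbertLE_dual {X Y F : Type*} [SeminormedAddCommGroup X] [NormedSpace ℂ X]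
    [SeminormedAddCommGroup Y] [NormedSpace ℂ Y] [AddCommGroup F] [Module ℂ F] {T : X →ₗ[ℂ] Y}
    (hT : IsNuclearMap T) (R : F →ₗ[ℂ] StrongDual ℂ Y) {p : Seminorm ℂ F}
    (hp : ∀ f (C : ℝ), 0 ≤ C → (∀ x, ‖R f (T x)‖ ≤ C * ‖x‖) → p f ≤ C) :
    HilbertLE p ((normSeminorm ℂ (StrongDual ℂ Y)).comp R) := by
  obtain ⟨ξ, y, hs, hT⟩ := hT
  set S : ℝ := ∑' n, ‖ξ n‖ * ‖y n‖
  have hS0 : 0 ≤ S := tsum_nonneg fun n => by positivity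
  -- The weight balances two demands: `a n` is bounded by `√(S‖ξ n‖‖y n‖)`, whose squares are
  -- summable, and Cauchy–Schwarz recovers `‖ξ n‖ ‖R f (y n)‖` with total constant `1`. If `‖y n‖ =
  -- 0`, the quotient is `0` by convention and `R f (y n)` vanishes too.
  set a : ℕ → F →ₗ[ℂ] ℂ := fun n =>
    ((√(S * (‖ξ n‖ / ‖y n‖)) : ℝ) : ℂ) • ((ContinuousLinearMap.coeLM ℂ).flip (y n) ∘ₗ R)
  have ha : ∀ n f, ‖a n f‖ = √(S * (‖ξ n‖ / ‖y n‖)) * ‖R f (y n)‖ := fun n f => by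
    change ‖((√(S * (‖ξ n‖ / ‖y n‖)) : ℝ) : ℂ) * R f (y n)‖ = _
    rw [norm_mul, Complex.norm_real, Real.norm_of_nonneg (Real.sqrt_nonneg _)]
  have hak : ∀ n f, ‖a n f‖ ≤ √(S * (‖ξ n‖ * ‖y n‖)) * ‖R f‖ := fun n f => by
    have h1 := (R f).le_opNorm (y n)
    rcases (norm_nonneg (y n)).eq_or_lt with h0 | h0
    · rw [ha, ← h0]
      simp
    · rw [ha]
      calc √(S * (‖ξ n‖ / ‖y n‖)) * ‖R f (y n)‖
          ≤ √(S * (‖ξ n‖ / ‖y n‖)) * (‖R f‖ * ‖y n‖) := by gcongr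
        _ = √(S * (‖ξ n‖ / ‖y n‖)) * √(‖y n‖ ^ 2) * ‖R f‖ := by
          rw [Real.sqrt_sq h0.le]
          ring
        _ = _ := by
          rw [← Real.sqrt_mul (by positivity)]
          congr 2
          field_simp
  have hks : Summable fun n => √(S * (‖ξ n‖ * ‖y n‖)) ^ 2 := by
    refine (hs.mul_left S).congr fun n => (Real.sq_sqrt (by positivity)).symm
  have has : ∀ f, Summable fun n => ‖a n f‖ ^ 2 := fun f => by
    refine Summable.of_nonneg_of_le (fun k => sq_nonneg _) (fun k => ?_)
      (hks.mul_right (‖R f‖ ^ 2))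
    rw [← mul_pow]
    exact pow_le_pow_left₀ (norm_nonneg _) (hak k f) 2
  obtain ⟨N, hN, hNa⟩ := exists_isHilbertian_tsum a has
  refine ⟨N, hN, fun f => ?_, twoSumming_tsum a has hNa hks hak⟩
  refine hp f (N f) (apply_nonneg _ _) fun x => ?_
  have hlim := ((R f).hasSum (hT x)).norm
  refine le_of_tendsto hlim (Eventually.of_forall fun s => ?_)
  have hterm : ∀ n, S * (‖ξ n‖ * ‖R f (y n)‖) ≤ √(S * (‖ξ n‖ * ‖y n‖)) * ‖a n f‖ := fun n => by
    rcases (norm_nonneg (y n)).eq_or_lt with h0 | h0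
    · have h1 : ‖R f (y n)‖ ≤ 0 := by
        have := (R f).le_opNorm (y n)
        rwa [← h0, mul_zero] at this
      rw [le_antisymm h1 (norm_nonneg _)]
      simp only [mul_zero]
      positivity
    · rw [ha, ← mul_assoc (√_) (√_), ← Real.sqrt_mul (by positivity)]
      have : S * (‖ξ n‖ * ‖y n‖) * (S * (‖ξ n‖ / ‖y n‖)) = (S * ‖ξ n‖) ^ 2 := by
        field_simp
      rw [this, Real.sqrt_sq (by positivity), mul_assoc]
  have hsum : ∑ n ∈ s, ‖ξ n‖ * ‖R f (y n)‖ ≤ N f := by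
    -- If `S = 0`, no division by `S` is possible, but then every term of the sum vanishes.
    rcases hS0.eq_or_lt with h0 | h0
    · have hz : ∀ n, ‖ξ n‖ * ‖R f (y n)‖ ≤ 0 := fun n => by
        have h1 : ‖ξ n‖ * ‖y n‖ ≤ 0 := by
          rw [h0]
          exact hs.le_tsum n fun j _ => by positivity
        calc ‖ξ n‖ * ‖R f (y n)‖ ≤ ‖ξ n‖ * (‖R f‖ * ‖y n‖) := by
              gcongr
              exact (R f).le_opNorm _
          _ = ‖R f‖ * (‖ξ n‖ * ‖y n‖) := by ring
          _ ≤ 0 := mul_nonpos_of_nonneg_of_nonpos (norm_nonneg _) h1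
      exact (Finset.sum_nonpos fun n _ => hz n).trans (apply_nonneg _ _)
    · refine le_of_mul_le_mul_left ?_ h0
      rw [Finset.mul_sum]
      refine (Finset.sum_le_sum fun n _ => hterm n).trans
        ((Real.sum_mul_le_sqrt_mul_sqrt s _ _).trans ?_)
      refine mul_le_mul (Real.sqrt_le_iff.2 ⟨hS0, ?_⟩)
        (Real.sqrt_le_iff.2 ⟨apply_nonneg _ _, ?_⟩) (Real.sqrt_nonneg _) hS0
      · simp only [Real.sq_sqrt (mul_nonneg hS0 (mul_nonneg (norm_nonneg (ξ _))
          (norm_nonneg (y _))))]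
        rw [← Finset.mul_sum, sq]
        exact mul_le_mul_of_nonneg_left (hs.sum_le_tsum s fun j _ => by positivity) hS0
      · rw [hNa]
        exact (has f).sum_le_tsum s fun j _ => sq_nonneg _
  refine (norm_sum_le _ _).trans ?_
  refine le_trans ?_ (mul_le_mul_of_nonneg_right hsum (norm_nonneg x))
  rw [Finset.sum_mul]
  refine Finset.sum_le_sum fun n _ => ?_
  rw [map_smul, norm_smul, mul_right_comm]
  exact mul_le_mul_of_nonneg_right ((ξ n).le_opNorm x) (norm_nonneg _)

end Transpose

/-! ### Continuous seminorms on strong duals -/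

section StrongDual

variable {E : Type*} [AddCommGroup E] [Module ℂ E] [TopologicalSpace E]

lemma exists_bound_of_continuous_strongDual [IsTopologicalAddGroup E] [ContinuousSMul ℂ E]
    {p : Seminorm ℂ (StrongDual ℂ E)} (hp : Continuous p) :
    ∃ (S : Set E) (C : ℝ), Bornology.IsVonNBounded ℂ S ∧ 0 < C ∧
      ∀ (f : StrongDual ℂ E) (t : ℝ), 0 ≤ t → (∀ x ∈ S, ‖f x‖ ≤ t) → p f ≤ C * t := by
  have h1 : {f | p f < 1} ∈ 𝓝 (0 : StrongDual ℂ E) :=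
    hp.continuousAt.preimage_mem_nhds (Iio_mem_nhds (by simp))
  obtain ⟨⟨S, V⟩, ⟨hS, hV⟩, hSV⟩ := ContinuousLinearMap.hasBasis_nhds_zero.mem_iff.1 h1
  obtain ⟨ε, hε, hεV⟩ := Metric.mem_nhds_iff.1 hV
  refine ⟨S, ε⁻¹, hS, inv_pos.2 hε, fun f t ht0 ht => ?_⟩
  have key : ∀ t' : ℝ, t < t' → p f ≤ ε⁻¹ * t' := fun t' ht' => by
    have ht'0 : 0 < t' := ht0.trans_lt ht'
    have hmem : ((ε / t' : ℝ) : ℂ) • f ∈ {f | p f < 1} := hSV fun x hx => hεV (by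
      rw [mem_ball_zero_iff, smul_apply, norm_smul, Complex.norm_real,
        Real.norm_of_nonneg (by positivity), div_mul_eq_mul_div, div_lt_iff₀ ht'0]
      exact mul_lt_mul_of_pos_left ((ht x hx).trans_lt ht') hε)
    have h2 : p (((ε / t' : ℝ) : ℂ) • f) < 1 := hmem
    rw [map_smul_eq_mul, Complex.norm_real, Real.norm_of_nonneg (by positivity),
      div_mul_eq_mul_div, div_lt_one ht'0] at h2
    rw [← div_eq_inv_mul, le_div_iff₀ hε]
    linarith
  have hcont : Tendsto (fun t' : ℝ => ε⁻¹ * t') (𝓝[>] t) (𝓝 (ε⁻¹ * t)) :=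
    (tendsto_id.mono_left nhdsWithin_le_nhds).const_mul _
  exact ge_of_tendsto hcont (eventually_nhdsWithin_of_forall key)

lemma continuous_strongDual_of_bound [IsTopologicalAddGroup E] [ContinuousSMul ℂ E]
    {p : Seminorm ℂ (StrongDual ℂ E)} {S : Set E} (hS : Bornology.IsVonNBounded ℂ S) {C : ℝ}
    (h : ∀ f : StrongDual ℂ E, (∀ x ∈ S, ‖f x‖ ≤ 1) → p f ≤ C) : Continuous p := by
  refine Seminorm.continuous' (r := C) ?_
  refine mem_of_superset (ContinuousLinearMap.hasBasis_nhds_zero.mem_of_mem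
    (i := (S, Metric.ball 0 1)) ⟨hS, Metric.ball_mem_nhds _ one_pos⟩) fun f hf => ?_
  rw [Seminorm.mem_closedBall_zero]
  exact h f fun x hx => (mem_ball_zero_iff.1 (hf x hx)).le

lemma exists_le_of_isVonNBounded {p : Seminorm ℂ E} (hp : Continuous p) {S : Set E}
    (hS : Bornology.IsVonNBounded ℂ S) : ∃ C : ℝ, ∀ x ∈ S, p x ≤ C := by
  have h1 : p.ball 0 1 ∈ 𝓝 (0 : E) := by
    rw [Seminorm.ball_zero_eq]
    exact hp.continuousAt.preimage_mem_nhds (Iio_mem_nhds (by simp))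
  obtain ⟨r, hr, h⟩ := (hS h1).exists_pos
  refine ⟨r, fun x hx => ?_⟩
  have h2 := h (r : ℂ) (by rw [Complex.norm_real, Real.norm_of_nonneg hr.le]) hx
  obtain ⟨v, hv, rfl⟩ := h2
  rw [Seminorm.mem_ball_zero] at hv
  change p ((r : ℂ) • v) ≤ r
  rw [map_smul_eq_mul, Complex.norm_real, Real.norm_of_nonneg hr.le]
  nlinarith

/-- The pairing of a space with its dual. -/
def dualPairing (E : Type*) [AddCommGroup E] [Module ℂ E] [TopologicalSpace E] :
    StrongDual ℂ E →ₗ[ℂ] E →ₗ[ℂ] ℂ :=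
  ContinuousLinearMap.coeLM ℂ

end StrongDual

end GelfandShilov

end

noncomputable section

namespace GelfandShilov

open Filter Topology Finset

variable {M A : WeightSequence} {d : ℕ}

/-! ### Nuclear inclusions between the steps -/

lemma isNuclearMap_comp_of_hilbertLE {X₀ X₁ X₂ X₃ : Type*}
    [SeminormedAddCommGroup X₀] [NormedSpace ℂ X₀] [SeminormedAddCommGroup X₁] [NormedSpace ℂ X₁]
    [SeminormedAddCommGroup X₂] [NormedSpace ℂ X₂] [SeminormedAddCommGroup X₃] [NormedSpace ℂ X₃]
    {T₁ : X₁ →ₗ[ℂ] X₀} {T₂ : X₂ →ₗ[ℂ] X₁} {T₃ : X₃ →ₗ[ℂ] X₂}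
    (h₁ : HilbertLE ((normSeminorm ℂ X₀).comp T₁) (normSeminorm ℂ X₁))
    (h₂ : HilbertLE ((normSeminorm ℂ X₁).comp T₂) (normSeminorm ℂ X₂))
    (h₃ : HilbertLE ((normSeminorm ℂ X₂).comp T₃) (normSeminorm ℂ X₃)) :
    IsNuclearMap (T₁ ∘ₗ T₂ ∘ₗ T₃) :=
  isNuclearMap_of_hilbertLE _ ((h₁.comp T₂).comp T₃) (h₂.comp T₃) h₃

/-- Dilation of the index by `c > 1` gives domination of the norms of the steps. -/
structure IsStepGain (M A : WeightSequence) (d : ℕ) (c : ℝ) : Prop where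
  one_lt : 1 < c
  hilbertLE : ∀ (h h' : PosReal), (h' : ℝ) = c * h →
    ∀ hle : stepSubmodule M A d h' ≤ stepSubmodule M A d h,
      HilbertLE ((normSeminorm ℂ (Step M A d h)).comp (Step.inclusion hle))
        (normSeminorm ℂ (Step M A d h'))

theorem exists_isStepGain (d : ℕ) (hM : M.Stable) (hA : A.Stable) (hA6 : A.DominatesFactorial) :
    ∃ c, IsStepGain M A d c := by
  obtain ⟨κ, hκ⟩ := WeightSequence.exists_isGain hM hA hA6
  have h2 := hκ.two_le
  -- One factor `κ` for the Sobolev estimate, one for two-summability.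
  refine ⟨κ * κ, by nlinarith, fun h h' hh' hle => ?_⟩
  obtain rfl : h' = PosReal.scale κ hκ.pos (PosReal.scale κ hκ.pos h) :=
    Subtype.ext (by rw [hh', mul_assoc]; rfl)
  exact Step.hilbertLE hκ hA6 h hle

namespace IsStepGain

variable {c : ℝ}

lemma pos (hc : IsStepGain M A d c) : 0 < c := one_pos.trans hc.one_lt

/-- Three dilations by `c`, one for each domination in the nuclearity criterion. -/
theorem isNuclearMap_inclusion (hc : IsStepGain M A d c) (hA : A.DominatesFactorial)
    {h h' : PosReal} (hh : (h' : ℝ) = c ^ 3 * h)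
    (hle : stepSubmodule M A d h' ≤ stepSubmodule M A d h) :
    IsNuclearMap (Step.inclusion hle) := by
  have h1 : ∀ k k' : PosReal, (k' : ℝ) = c * k → stepSubmodule M A d k' ≤ stepSubmodule M A d k :=
    fun k k' hk => stepSubmodule_anti hA (by
      change (k : ℝ) ≤ k'
      rw [hk]
      exact le_mul_of_one_le_left k.2.le hc.one_lt.le)
  obtain ⟨a, ha⟩ : ∃ a : PosReal, (a : ℝ) = c * h := ⟨PosReal.scale c hc.pos h, rfl⟩
  obtain ⟨b, hb⟩ : ∃ b : PosReal, (b : ℝ) = c * a := ⟨PosReal.scale c hc.pos a, rfl⟩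
  have he : (h' : ℝ) = c * b := by
    rw [hh, hb, ha]
    ring
  have hcomp : Step.inclusion hle = Step.inclusion (h1 _ _ ha) ∘ₗ Step.inclusion (h1 _ _ hb) ∘ₗ
      Step.inclusion (h1 _ _ he) := LinearMap.ext fun φ => Step.ext (by
    simp only [LinearMap.comp_apply, Step.fn_inclusion])
  rw [hcomp]
  exact isNuclearMap_comp_of_hilbertLE (hc.hilbertLE h a ha _) (hc.hilbertLE a b hb _)
    (hc.hilbertLE b h' he _)

end IsStepGain

/-! ### The Beurling space -/

namespace Beurling

instance : IsTopologicalAddGroup (Beurling M A d) :=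
  topologicalAddGroup_iInf fun h => topologicalAddGroup_induced (toStep M A d h)

instance : ContinuousSMul ℂ (Beurling M A d) :=
  continuousSMul_iInf fun h => continuousSMul_induced (toStep M A d h)

instance : LocallyConvexSpace ℝ (Beurling M A d) :=
  LocallyConvexSpace.iInf fun h =>
    letI : LocallyConvexSpace ℝ (Step M A d h) := NormedSpace.toLocallyConvexSpace' ℂ
    LocallyConvexSpace.induced ((toStep M A d h).restrictScalars ℝ)

lemma continuous_toStep (h : PosReal) : Continuous (toStep M A d h) :=
  continuous_iInf_dom continuous_induced_dom

instance : T2Space (Beurling M A d) :=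
  T2Space.of_injective_continuous (f := toStep M A d ⟨1, one_pos⟩)
    (Submodule.inclusion_injective _) (continuous_toStep _)

lemma fn_toStep (h : PosReal) (x : Beurling M A d) : (toStep M A d h x).fn = x.1 := rfl

lemma inclusion_toStep {h h' : PosReal} (hle : stepSubmodule M A d h' ≤ stepSubmodule M A d h)
    (x : Beurling M A d) : Step.inclusion hle (toStep M A d h' x) = toStep M A d h x :=
  Step.ext (by rw [Step.fn_inclusion, fn_toStep, fn_toStep])

variable (M A d) in
/-- The norm `σ_h` on the projective limit. -/
def stepNorm (h : PosReal) : Seminorm ℂ (Beurling M A d) :=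
  (normSeminorm ℂ (Step M A d h)).comp (toStep M A d h)

lemma continuous_stepNorm (h : PosReal) : Continuous (stepNorm M A d h) :=
  continuous_norm.comp (continuous_toStep h)

variable (M A d) in
lemma withSeminorms : WithSeminorms (SeminormFamily.sigma fun (h : PosReal) (_ : Fin 1) =>
    stepNorm M A d h) :=
  withSeminorms_iInf fun h =>
    LinearMap.withSeminorms_induced (norm_withSeminorms ℂ (Step M A d h)) (toStep M A d h)

lemma stepNorm_mono (hA : A.DominatesFactorial) {h h' : PosReal} (hh : h ≤ h')
    (x : Beurling M A d) : stepNorm M A d h x ≤ stepNorm M A d h' x := by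
  change ‖toStep M A d h x‖ ≤ ‖toStep M A d h' x‖
  rw [← inclusion_toStep (stepSubmodule_anti hA hh) x]
  exact Step.norm_inclusion_le hA hh _ _

/-- The norms increase with the index, so finitely many of them are dominated by one. -/
lemma exists_le_stepNorm (hA : A.DominatesFactorial) {p : Seminorm ℂ (Beurling M A d)}
    (hp : Continuous p) : ∃ (h : PosReal) (C : ℝ), 0 ≤ C ∧ ∀ x, p x ≤ C * stepNorm M A d h x := by
  obtain ⟨s, C, -, hC⟩ := Seminorm.bound_of_continuous (withSeminorms M A d) p hp
  obtain ⟨h, hh⟩ := (s.image Sigma.fst).exists_le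
  refine ⟨h, C, C.2, fun x => (hC x).trans ?_⟩
  refine mul_le_mul_of_nonneg_left ?_ C.2
  exact Seminorm.finset_sup_apply_le (apply_nonneg _ _) fun k hk =>
    stepNorm_mono hA (hh _ (Finset.mem_image_of_mem _ hk)) x

lemma hilbertLE_stepNorm {c : ℝ} (hc : IsStepGain M A d c) (hA : A.DominatesFactorial)
    {h h' : PosReal} (hh : (h' : ℝ) = c * h) :
    HilbertLE (stepNorm M A d h) (stepNorm M A d h') := by
  have hle : h ≤ h' := by
    change (h : ℝ) ≤ h'
    rw [hh]
    exact le_mul_of_one_le_left h.2.le hc.one_lt.le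
  have hsub := stepSubmodule_anti (M := M) (d := d) hA hle
  have hcomp : stepNorm M A d h =
      ((normSeminorm ℂ (Step M A d h)).comp (Step.inclusion hsub)).comp (toStep M A d h') :=
    Seminorm.ext fun x => by
      change ‖toStep M A d h x‖ = ‖Step.inclusion hsub (toStep M A d h' x)‖
      rw [inclusion_toStep]
  rw [hcomp]
  exact (hc.hilbertLE h h' hh hsub).comp (toStep M A d h')

theorem isNuclearSpace {c : ℝ} (hc : IsStepGain M A d c) (hA : A.DominatesFactorial) :
    IsNuclearSpace (Beurling M A d) := by
  refine IsNuclearSpace.of_hilbertLE fun p hp => ?_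
  obtain ⟨h, C, hC0, hC⟩ := exists_le_stepNorm hA hp
  exact ⟨stepNorm M A d (PosReal.scale c hc.pos h), continuous_stepNorm _,
    (hilbertLE_stepNorm hc hA rfl).mono hC0 hC one_pos fun x => (one_mul _).ge⟩

theorem isNuclearSpace_strongDual {c : ℝ} (hc : IsStepGain M A d c) (hA : A.DominatesFactorial) :
    IsNuclearSpace (StrongDual ℂ (Beurling M A d)) := by
  refine IsNuclearSpace.of_hilbertLE fun p hp => ?_
  -- Cofinal because `c > 1`, and consecutive indices have ratio `c`, as the domination requires.
  set u : ℕ → PosReal := fun n => ⟨c ^ n, pow_pos hc.pos n⟩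
  have hu : ∀ h : PosReal, ∃ n, h ≤ u n := fun h => by
    obtain ⟨n, hn⟩ := pow_unbounded_of_one_lt (h : ℝ) hc.one_lt
    exact ⟨n, hn.le⟩
  have hlt : ∀ n, HilbertLE (stepNorm M A d (u n)) (stepNorm M A d (u (n + 1))) := fun n =>
    hilbertLE_stepNorm hc hA (pow_succ' c n)
  have hB : ∀ f : StrongDual ℂ (Beurling M A d), ∃ (n : ℕ) (C : ℝ), 0 ≤ C ∧
      ∀ x, ‖dualPairing (Beurling M A d) f x‖ ≤ C * stepNorm M A d (u n) x := fun f => by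
    obtain ⟨h, C, hC0, hC⟩ := exists_le_stepNorm hA
      (p := (normSeminorm ℂ ℂ).comp f.toLinearMap) (continuous_norm.comp f.continuous)
    obtain ⟨n, hn⟩ := hu h
    exact ⟨n, C, hC0, fun x => (hC x).trans
      (mul_le_mul_of_nonneg_left (stepNorm_mono hA hn x) hC0)⟩
  obtain ⟨S, C, hS, hC0, hC⟩ := exists_bound_of_continuous_strongDual hp
  have hSb : SeminormBounded (fun n => stepNorm M A d (u n)) S := fun n =>
    exists_le_of_isVonNBounded (continuous_stepNorm _) hS
  obtain ⟨V, W, hSV, hV, hW, hVW⟩ := SeminormBounded.exists_hilbertLE hlt hB hSb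
  refine ⟨polarSeminorm (dualPairing _) W, ?_, hVW.mono hC0.le (fun f => ?_) one_pos
    fun x => (one_mul _).ge⟩
  -- Boundedness along the cofinal sequence gives boundedness for every `σ_h`, so `W` is bounded and
  -- its polar seminorm is continuous on the strong dual.
  · have hWb : Bornology.IsVonNBounded ℂ W := by
      refine (withSeminorms M A d).isVonNBounded_iff_seminorm_bddAbove.2 fun k => ?_
      obtain ⟨n, hn⟩ := hu k.1
      obtain ⟨K, hK⟩ := hW n
      refine ⟨K, ?_⟩
      rintro _ ⟨x, hx, rfl⟩
      exact (stepNorm_mono hA hn x).trans (hK x hx)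
    exact continuous_strongDual_of_bound hWb fun f hf =>
      (hW.pointwiseBounded hB).polarSeminorm_le zero_le_one hf
  · exact hC f _ (apply_nonneg _ _) fun x hx =>
      (hV.pointwiseBounded hB).le_polarSeminorm (hSV hx) f

end Beurling

end GelfandShilov

end

noncomputable section

namespace GelfandShilov

open Filter Topology Finset

variable {M A : WeightSequence} {d : ℕ}

/-! ### The Roumieu space -/

namespace Roumieu

instance : IsTopologicalAddGroup (Roumieu M A d) :=
  topologicalAddGroup_sInf fun _ ht => ht.2.1

instance : ContinuousSMul ℂ (Roumieu M A d) :=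
  continuousSMul_sInf fun _ ht => ht.2.2.1

instance : LocallyConvexSpace ℝ (Roumieu M A d) :=
  LocallyConvexSpace.sInf fun _ ht => ht.2.2.2

variable (M A d) in
/-- The continuous inclusion of a step into the inductive limit. -/
def ofStepL (h : PosReal) : Step M A d h →L[ℂ] Roumieu M A d :=
  ⟨ofStep M A d h, continuous_sInf_rng.2 fun _ ht => ht.1 h⟩

lemma coe_ofStepL (h : PosReal) (φ : Step M A d h) : (ofStepL M A d h φ).1 = φ.fn := rfl

lemma ofStepL_inclusion {h h' : PosReal} (hle : stepSubmodule M A d h' ≤ stepSubmodule M A d h)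
    (φ : Step M A d h') : ofStepL M A d h (Step.inclusion hle φ) = ofStepL M A d h' φ :=
  Subtype.ext (by rw [coe_ofStepL, coe_ofStepL, Step.fn_inclusion])

/-- The topology defined by `p` alone is locally convex and makes all inclusions continuous, so it
competes in the infimum and is coarser than the inductive limit topology. -/
lemma continuous_of_bound {p : Seminorm ℂ (Roumieu M A d)}
    (hp : ∀ h, ∃ C : ℝ, ∀ φ, p (ofStepL M A d h φ) ≤ C * ‖φ‖) : Continuous p := by
  let t : TopologicalSpace (Roumieu M A d) :=
    inferInstanceAs (TopologicalSpace (SeminormSpace p))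
  have ht : Continuous[t, _] p := continuous_norm (E := SeminormSpace p)
  refine continuous_le_dom (sInf_le ⟨fun h => ?_, ?_, ?_, ?_⟩) ht
  · obtain ⟨C, hC⟩ := hp h
    let T : Step M A d h →ₗ[ℂ] SeminormSpace p :=
      { toFun := fun φ => ofStep M A d h φ
        map_add' := fun _ _ => rfl
        map_smul' := fun _ _ => rfl }
    exact (T.mkContinuous C hC).continuous
  · exact inferInstanceAs (IsTopologicalAddGroup (SeminormSpace p))
  · exact inferInstanceAs (ContinuousSMul ℂ (SeminormSpace p))
  · exact NormedSpace.toLocallyConvexSpace' ℂ (E := SeminormSpace p)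

lemma exists_bound_of_continuous {p : Seminorm ℂ (Roumieu M A d)} (hp : Continuous p)
    (h : PosReal) : ∃ C : ℝ, 0 < C ∧ ∀ φ, p (ofStepL M A d h φ) ≤ C * ‖φ‖ :=
  Seminorm.bound_of_continuous_normedSpace (p.comp (ofStepL M A d h).toLinearMap)
    (hp.comp (ofStepL M A d h).continuous)

lemma continuous_of_norm_le {p : Seminorm ℂ (Roumieu M A d)} (hp : Continuous p)
    {f : Roumieu M A d →ₗ[ℂ] ℂ} (hf : ∀ x, ‖f x‖ ≤ p x) : Continuous f := by
  refine continuous_of_continuousAt_zero f ?_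
  rw [ContinuousAt, map_zero]
  have h0 : Tendsto p (𝓝 0) (𝓝 0) := by simpa using hp.tendsto 0
  exact squeeze_zero_norm hf h0

/-- Evaluation at a point. -/
def evalAt (x : EuclideanSpace ℝ (Fin d)) : Roumieu M A d →ₗ[ℂ] ℂ :=
  LinearMap.proj x ∘ₗ (roumieuSubmodule M A d).subtype

/-- The multi-index `0` and `e^A ≥ 1` give `|φ(x)| ≤ σ_h(φ)` for every `h`. These functionals
separate points, whence the Hausdorff property. -/
lemma continuous_evalAt (x : EuclideanSpace ℝ (Fin d)) :
    Continuous (evalAt (M := M) (A := A) x) := by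
  refine continuous_of_norm_le (p := (normSeminorm ℂ ℂ).comp (evalAt x))
    (continuous_of_bound fun h => ⟨1, fun φ => ?_⟩) fun _ => le_rfl
  rw [one_mul]
  refine le_trans ?_ (φ.stepTerm_le_norm (0, x))
  have h1 : stepTerm M A h φ.fn (0, x) = Real.exp (A.assoc (h * ‖x‖)) * ‖φ.fn x‖ := by
    simp [stepTerm, multiDeriv_zero_index, M.map_zero]
  rw [h1]
  exact le_mul_of_one_le_left (norm_nonneg (φ.fn x)) (WeightSequence.one_le_exp_assoc _)

instance : T2Space (Roumieu M A d) :=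
  T2Space.of_injective_continuous
    (f := fun (φ : Roumieu M A d) (x : EuclideanSpace ℝ (Fin d)) => evalAt x φ)
    (fun _ _ h => Subtype.ext h) (continuous_pi fun x => continuous_evalAt x)

/-- The steps form a chain under (M.6), so their supremum as subspaces is their union. -/
lemma exists_ofStepL_eq (hA : A.DominatesFactorial) (x : Roumieu M A d) :
    ∃ (h : PosReal) (φ : Step M A d h), ofStepL M A d h φ = x := by
  have hdir : Directed (· ≤ ·) fun h : PosReal => stepSubmodule M A d h := fun a b =>
    ⟨min a b, stepSubmodule_anti hA (min_le_left _ _), stepSubmodule_anti hA (min_le_right _ _)⟩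
  have : Nonempty PosReal := ⟨⟨1, one_pos⟩⟩
  obtain ⟨h, hx⟩ := (Submodule.mem_iSup_of_directed _ hdir).1 x.2
  exact ⟨h, ⟨x.1, hx⟩, rfl⟩

variable (M A d) in
/-- Restriction of functionals to a step. -/
def restrictStep (h : PosReal) :
    StrongDual ℂ (Roumieu M A d) →L[ℂ] StrongDual ℂ (Step M A d h) :=
  ContinuousLinearMap.precomp ℂ (ofStepL M A d h)

variable (M A d) in
/-- The dual norm of the restriction of a functional to a step. -/
def dualNorm (h : PosReal) : Seminorm ℂ (StrongDual ℂ (Roumieu M A d)) :=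
  (normSeminorm ℂ (StrongDual ℂ (Step M A d h))).comp (restrictStep M A d h).toLinearMap

lemma continuous_dualNorm (h : PosReal) : Continuous (dualNorm M A d h) :=
  continuous_norm.comp (restrictStep M A d h).continuous

lemma norm_apply_le_dualNorm {h : PosReal} (f : StrongDual ℂ (Roumieu M A d))
    (φ : Step M A d h) : ‖f (ofStepL M A d h φ)‖ ≤ dualNorm M A d h f * ‖φ‖ :=
  (restrictStep M A d h f).le_opNorm φ

lemma dualNorm_le {h : PosReal} {f : StrongDual ℂ (Roumieu M A d)} {C : ℝ} (hC0 : 0 ≤ C)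
    (hC : ∀ φ, ‖f (ofStepL M A d h φ)‖ ≤ C * ‖φ‖) : dualNorm M A d h f ≤ C :=
  (restrictStep M A d h f).opNorm_le_bound hC0 hC

lemma dualNorm_anti (hA : A.DominatesFactorial) {h h' : PosReal} (hh : h ≤ h')
    (f : StrongDual ℂ (Roumieu M A d)) : dualNorm M A d h' f ≤ dualNorm M A d h f :=
  dualNorm_le (apply_nonneg _ _) fun φ => by
    have hle := stepSubmodule_anti (M := M) (d := d) hA hh
    rw [← ofStepL_inclusion hle]
    exact (norm_apply_le_dualNorm f _).trans
      (mul_le_mul_of_nonneg_left (Step.norm_inclusion_le hA hh hle φ) (apply_nonneg _ _))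

/-- Transposition reverses the order: the dual norm of the larger index `h'` is dominated by that of
the smaller `h`. -/
lemma hilbertLE_dualNorm {c : ℝ} (hc : IsStepGain M A d c) (hA : A.DominatesFactorial)
    {h h' : PosReal} (hh : (h' : ℝ) = c ^ 3 * h) :
    HilbertLE (dualNorm M A d h') (dualNorm M A d h) := by
  have hle : h ≤ h' := by
    change (h : ℝ) ≤ h'
    rw [hh]
    exact le_mul_of_one_le_left h.2.le (one_le_pow₀ hc.one_lt.le)
  have hsub := stepSubmodule_anti (M := M) (d := d) hA hle
  refine (hc.isNuclearMap_inclusion hA hh hsub).hilbertLE_dual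
    (restrictStep M A d h).toLinearMap fun f C hC0 hC => dualNorm_le hC0 fun φ => ?_
  rw [← ofStepL_inclusion hsub]
  exact hC φ

/-- A sequence of indices that is cofinal at `0`. -/
def index {c : ℝ} (hc : IsStepGain M A d c) (n : ℕ) : PosReal :=
  ⟨((c ^ 3) ^ n)⁻¹, inv_pos.2 (pow_pos (pow_pos hc.pos 3) n)⟩

/-! ### Duality along a sequence of indices tending to zero. -/

section index

variable {c : ℝ}

lemma index_eq (hc : IsStepGain M A d c) (n : ℕ) : (index hc n : ℝ) = c ^ 3 * index hc (n + 1) := by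
  have := hc.pos
  change ((c ^ 3) ^ n)⁻¹ = c ^ 3 * ((c ^ 3) ^ (n + 1))⁻¹
  rw [pow_succ' (c ^ 3), mul_inv, mul_inv_cancel_left₀ (pow_pos this 3).ne']

lemma index_antitone (hc : IsStepGain M A d c) : Antitone (index hc) := antitone_nat_of_succ_le fun n => by
  change (index hc (n + 1) : ℝ) ≤ index hc n
  rw [index_eq hc n]
  exact le_mul_of_one_le_left (index hc (n + 1)).2.le (one_le_pow₀ hc.one_lt.le)

lemma exists_index_le (hc : IsStepGain M A d c) (h : PosReal) : ∃ n, index hc n ≤ h := by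
  obtain ⟨n, hn⟩ := pow_unbounded_of_one_lt ((h : ℝ)⁻¹) (one_lt_pow₀ hc.one_lt three_ne_zero)
  exact ⟨n, inv_le_of_inv_le₀ h.2 hn.le⟩

lemma exists_norm_apply_le (hc : IsStepGain M A d c) (hA : A.DominatesFactorial)
    (x : Roumieu M A d) :
    ∃ (n : ℕ) (C : ℝ), 0 ≤ C ∧
      ∀ f, ‖(dualPairing (Roumieu M A d)).flip x f‖ ≤ C * dualNorm M A d (index hc n) f := by
  obtain ⟨h, φ, rfl⟩ := exists_ofStepL_eq hA x
  obtain ⟨n, hn⟩ := exists_index_le hc h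
  refine ⟨n, ‖φ‖, norm_nonneg _, fun f => (norm_apply_le_dualNorm f φ).trans ?_⟩
  rw [mul_comm]
  exact mul_le_mul_of_nonneg_left (dualNorm_anti hA hn f) (norm_nonneg _)

/-- A set bounded in all dual norms is bounded on the unit ball of every step, hence equicontinuous.
-/
lemma continuous_polarSeminorm (hc : IsStepGain M A d c) (hA : A.DominatesFactorial)
    {W : Set (StrongDual ℂ (Roumieu M A d))}
    (hW : SeminormBounded (fun n => dualNorm M A d (index hc n)) W) :
    Continuous (polarSeminorm (dualPairing (Roumieu M A d)).flip W) := by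
  refine continuous_of_bound fun h => ?_
  obtain ⟨n, hn⟩ := exists_index_le hc h
  obtain ⟨K, hK⟩ := hW n
  -- `W` may be empty, in which case `K` can be negative.
  refine ⟨max K 0, fun φ => ?_⟩
  refine (hW.pointwiseBounded (exists_norm_apply_le hc hA)).polarSeminorm_le
    (mul_nonneg (le_max_right _ _) (norm_nonneg _)) fun f hf => ?_
  exact (norm_apply_le_dualNorm f φ).trans (mul_le_mul_of_nonneg_right
    (((dualNorm_anti hA hn f).trans (hK f hf)).trans (le_max_left _ _)) (norm_nonneg _))

theorem isNuclearSpace (hc : IsStepGain M A d c) (hA : A.DominatesFactorial) :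
    IsNuclearSpace (Roumieu M A d) := by
  refine IsNuclearSpace.of_hilbertLE fun p hp => ?_
  have hB := exists_norm_apply_le hc hA
  -- The polar of the unit ball of `p`; it is bounded in every dual norm because `p` is continuous
  -- on each step.
  set U : Set (StrongDual ℂ (Roumieu M A d)) := {f | ∀ x, ‖f x‖ ≤ p x}
  have hU : SeminormBounded (fun n => dualNorm M A d (index hc n)) U := fun n => by
    obtain ⟨C, hC0, hC⟩ := exists_bound_of_continuous hp (index hc n)
    exact ⟨C, fun f hf => dualNorm_le hC0.le fun φ => (hf _).trans (hC φ)⟩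
  obtain ⟨V, W, hUV, hV, hW, hVW⟩ := SeminormBounded.exists_hilbertLE
    (fun n => hilbertLE_dualNorm hc hA (index_eq hc n)) hB hU
  refine ⟨_, continuous_polarSeminorm hc hA hW, hVW.mono zero_le_one (fun x => ?_) one_pos
    fun x => (one_mul _).ge⟩
  -- Hahn–Banach in the space seminormed by `p`: a functional in `U` attains `p x`, so `p` is at
  -- most the polar seminorm of `V ⊇ U`.
  obtain ⟨g, hg1, hg⟩ := exists_dual_vector'' ℂ (E := SeminormSpace p) x
  let f : Roumieu M A d →ₗ[ℂ] ℂ :=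
    { toFun := fun y => g y
      map_add' := fun y z => g.map_add y z
      map_smul' := fun a y => g.map_smul a y }
  have hf : ∀ y, ‖f y‖ ≤ p y := fun y =>
    (g.le_of_opNorm_le hg1 y).trans_eq (one_mul _)
  have hmem : (⟨f, continuous_of_norm_le hp hf⟩ : StrongDual ℂ (Roumieu M A d)) ∈ V := hUV hf
  rw [one_mul]
  refine le_trans (le_of_eq ?_) ((hV.pointwiseBounded hB).le_polarSeminorm hmem x)
  change p x = ‖g x‖
  rw [hg]
  exact (RCLike.norm_ofReal _ |>.trans (abs_of_nonneg (apply_nonneg p x))).symm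

/-- Bounded sets are bounded uniformly with respect to one dual norm. -/
lemma exists_dualNorm_bound (hc : IsStepGain M A d c) (hA : A.DominatesFactorial)
    {S : Set (Roumieu M A d)} (hS : Bornology.IsVonNBounded ℂ S) :
    ∃ n : ℕ, ∀ x ∈ S, ∀ f : StrongDual ℂ (Roumieu M A d),
      ‖f x‖ ≤ n * dualNorm M A d (index hc n) f := by
  by_contra! hcon
  choose x hxS f hf using hcon
  have hpos : ∀ n, 0 < ‖f n (x n)‖ := fun n =>
    (mul_nonneg n.cast_nonneg (apply_nonneg _ _)).trans_lt (hf n)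
  -- Rescaled so that `|g n (x n)| = n` while the dual norm of index `n` is at most `1`.
  set g : ℕ → StrongDual ℂ (Roumieu M A d) := fun n => ((n / ‖f n (x n)‖ : ℝ) : ℂ) • f n
  have hnorm : ∀ n : ℕ, ‖((n / ‖f n (x n)‖ : ℝ) : ℂ)‖ = n / ‖f n (x n)‖ := fun n => by
    rw [Complex.norm_real, Real.norm_of_nonneg (by positivity)]
  have hg1 : ∀ n, dualNorm M A d (index hc n) (g n) ≤ 1 := fun n => by
    rw [map_smul_eq_mul, hnorm, div_mul_eq_mul_div, div_le_one (hpos n)]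
    exact (hf n).le
  have hgx : ∀ n : ℕ, ‖g n (x n)‖ = n := fun n => by
    rw [smul_apply, norm_smul, hnorm, div_mul_cancel₀ _ (hpos n).ne']
  -- For `n ≥ m` the dual norm of index `m` is at most that of index `n`; the finitely many earlier
  -- functionals enter through the sum. The polar of the `g n` is then continuous, hence bounded on
  -- `S`, which contradicts `|g n (x n)| = n`.
  have hG : SeminormBounded (fun n => dualNorm M A d (index hc n)) (Set.range g) := fun m => by
    refine ⟨1 + ∑ k ∈ range m, dualNorm M A d (index hc m) (g k), ?_⟩
    rintro _ ⟨n, rfl⟩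
    have hsum : 0 ≤ ∑ k ∈ range m, dualNorm M A d (index hc m) (g k) :=
      Finset.sum_nonneg fun _ _ => apply_nonneg _ _
    rcases lt_or_ge n m with h | h
    · have := Finset.single_le_sum (f := fun k => dualNorm M A d (index hc m) (g k))
        (fun _ _ => apply_nonneg _ _) (mem_range.2 h)
      exact this.trans (le_add_of_nonneg_left zero_le_one)
    · exact ((dualNorm_anti hA (index_antitone hc h) _).trans (hg1 n)).trans
        (le_add_of_nonneg_right hsum)
  obtain ⟨K, hK⟩ := exists_le_of_isVonNBounded (continuous_polarSeminorm hc hA hG) hS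
  obtain ⟨n, hn⟩ := exists_nat_gt K
  have h1 := (hG.pointwiseBounded (exists_norm_apply_le hc hA)).le_polarSeminorm
    (Set.mem_range_self n) (x n)
  exact absurd ((hgx n).symm.le.trans (h1.trans (hK _ (hxS n)))) (not_le.2 hn)

theorem isNuclearSpace_strongDual (hc : IsStepGain M A d c) (hA : A.DominatesFactorial) :
    IsNuclearSpace (StrongDual ℂ (Roumieu M A d)) := by
  refine IsNuclearSpace.of_hilbertLE fun p hp => ?_
  obtain ⟨S, C, hS, hC0, hC⟩ := exists_bound_of_continuous_strongDual hp
  obtain ⟨n, hn⟩ := exists_dualNorm_bound hc hA hS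
  -- Since `p ≤ C n` times the dual norm of index `n`, one further index supplies the domination.
  refine ⟨dualNorm M A d (index hc (n + 1)), continuous_dualNorm _,
    (hilbertLE_dualNorm hc hA (index_eq hc n)).mono (C := C * n) (by positivity) (fun f => ?_)
      one_pos fun x => (one_mul _).ge⟩
  rw [mul_assoc]
  exact hC f _ (mul_nonneg n.cast_nonneg (apply_nonneg _ _)) fun x hx => hn x hx f

end index

end Roumieu

end GelfandShilov

end

theorem mainTheorem7 (d : ℕ) (M A : GelfandShilov.WeightSequence)
    (hM1 : M.LogConvex) (hM2 : M.Stable) (hM5 : M.PowerStronglyNonQuasianalytic)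
    (hA1 : A.LogConvex) (hA2 : A.Stable) (hA6 : A.DominatesFactorial) :
    -- nuclearity of the inclusions between the steps, both cases
    (∀ h : GelfandShilov.PosReal, ∃ h₁ : GelfandShilov.PosReal, h < h₁ ∧
      ∃ hle : GelfandShilov.stepSubmodule M A d h₁ ≤ GelfandShilov.stepSubmodule M A d h,
        GelfandShilov.IsNuclearMap (GelfandShilov.Step.inclusion hle)) ∧
    (∀ h : GelfandShilov.PosReal, ∃ h₁ : GelfandShilov.PosReal, h₁ < h ∧
      ∃ hle : GelfandShilov.stepSubmodule M A d h ≤ GelfandShilov.stepSubmodule M A d h₁,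
        GelfandShilov.IsNuclearMap (GelfandShilov.Step.inclusion hle)) ∧
    -- nuclearity of the spaces
    GelfandShilov.IsNuclearSpace (GelfandShilov.Beurling M A d) ∧
    GelfandShilov.IsNuclearSpace (GelfandShilov.Roumieu M A d) ∧
    -- nuclearity of their strong duals
    GelfandShilov.IsNuclearSpace (StrongDual ℂ (GelfandShilov.Beurling M A d)) ∧
    GelfandShilov.IsNuclearSpace (StrongDual ℂ (GelfandShilov.Roumieu M A d)) := by
  obtain ⟨c, hc⟩ := GelfandShilov.exists_isStepGain d hM2 hA2 hA6
  have hc3 : 1 < c ^ 3 := one_lt_pow₀ hc.one_lt three_ne_zero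
  have hc0 : 0 < c ^ 3 := one_pos.trans hc3
  refine ⟨fun h => ?_, fun h => ?_, GelfandShilov.Beurling.isNuclearSpace hc hA6,
    GelfandShilov.Roumieu.isNuclearSpace hc hA6,
    GelfandShilov.Beurling.isNuclearSpace_strongDual hc hA6,
    GelfandShilov.Roumieu.isNuclearSpace_strongDual hc hA6⟩
  · have hlt : h < ⟨c ^ 3 * h, mul_pos hc0 h.2⟩ := lt_mul_of_one_lt_left h.2 hc3
    exact ⟨_, hlt, GelfandShilov.stepSubmodule_anti hA6 hlt.le,
      hc.isNuclearMap_inclusion hA6 rfl _⟩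
  · have hlt : (⟨h / c ^ 3, div_pos h.2 hc0⟩ : GelfandShilov.PosReal) < h :=
      div_lt_self h.2 hc3
    exact ⟨_, hlt, GelfandShilov.stepSubmodule_anti hA6 hlt.le,
      hc.isNuclearMap_inclusion hA6 (mul_div_cancel₀ (h : ℝ) hc0.ne').symm _⟩
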